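/- Let $\mathbf{Hot}$ be the homotopy category of unpointed spaces: its objects are the (small) CW-complexes and its morphisms are the homotopy classes of continuous maps. Let $\mathbf{Hot}_c$ be its full subcategory on the connected CW-complexes. A set $\mathcal G$ of objects of a category $\mathbf C$ *jointly reflects isomorphisms* if every morphism $f\colon X\to Y$ in $\mathbf C$ such that $f_*\colon \mathbf C(S,X)\to \mathbf C(S,Y)$ is a bijection for every $S\in\mathcal G$ is an isomorphism. "Set" means small set. For an ordinal $\alpha$, let $\Sigma_\alpha$ be the group of all bijections of the set $\alpha$. For a regular cardinal $\alpha$ (regarded as an initial ordinal; regular cardinals are infinite), let $\Sigma^{c}_\alpha\subseteq\Sigma_\alpha$ be the group of essentially constant permutations, i.e. the union of the images of the inclusions $\Sigma_\beta\hookrightarrow\Sigma_\alpha$ (extension by the identity) for $\beta<\alpha$. Let $s\colon\Sigma^{c}_\alpha\to\Sigma^{c}_\alpha$ be the shift homomorphism given by $(s\sigma)(\gamma'+1)=\sigma(\gamma')+1$ for $\gamma'<\alpha$, and $(s\sigma)(\gamma)=\gamma$ if $\gamma<\alpha$ is zero or a limit ordinal. Let $B$ denote the classifying space functor on discrete groups,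 i.e. the geometric realization of the nerve. **Theorem 2.1.** 1. No set $\mathcal G$ of spaces jointly reflects isomorphisms in $\mathbf{Hot}$. 2. Let $\mathcal G$ be any set of spaces. There is a regular cardinal $\alpha$ larger than the cardinality of $\pi_1(S,s_0)$ for all $S\in\mathcal G$ and all $s_0\in S$. For every such $\alpha$, the space $B\Sigma^{c}_\alpha$ is a connected CW-complex, the map $Bs\colon B\Sigma^{c}_\alpha\to B\Sigma^{c}_\alpha$ is not a homotopy equivalence (not an isomorphism in $\mathbf{Hot}$), and $Bs$ induces the identity on $\mathbf{Hot}(S,B\Sigma^{c}_\alpha)$ for every $S\in\mathcal G$. 3. No set $\mathcal G$ of connected spaces jointly reflects isomorphisms in $\mathbf{Hot}_c$. -/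

import Mathlib

open CategoryTheory

universe u

noncomputable section

/-! ### Joint reflection of isomorphisms -/

/-- A class `G` of objects of a category *jointly reflects isomorphisms* if a morphism `f : X ⟶ Y`
is an isomorphism whenever `f_* : C(S, X) → C(S, Y)` is a bijection for every `S ∈ G`. That `G` is
a *set*, that is, a small set, is expressed separately by `Small`. -/
def JointlyReflectsIsos {C : Type*} [Category C] (G : Set C) : Prop :=
  ∀ ⦃X Y : C⦄ (f : X ⟶ Y),
    (∀ S ∈ G, Function.Bijective (fun g : S ⟶ X => g ≫ f)) → IsIso f

/-! ### The homotopy category of spaces -/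

/-- The objects of the homotopy category of spaces: spaces which admit the structure of a
CW-complex. -/
structure Hot : Type (u + 1) where
  space : TopCat.{u}
  isCW : Nonempty (TopCat.CWComplex space)

namespace Hot

/-- The homotopy relation on continuous maps. -/
def homotopySetoid (X Y : Hot.{u}) : Setoid C(X.space, Y.space) where
  r := ContinuousMap.Homotopic
  iseqv := ContinuousMap.Homotopic.equivalence

/-- Morphisms in the homotopy category are (unpointed) homotopy classes of continuous maps. -/
instance category : LargeCategory Hot.{u} where
  Hom X Y := Quotient (homotopySetoid X Y)
  id X := Quotient.mk _ (ContinuousMap.id X.space)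
  comp {X Y Z} f g := Quotient.map₂ (sa := homotopySetoid X Y) (sb := homotopySetoid Y Z)
    (sc := homotopySetoid X Z) (fun f g => g.comp f)
    (fun _ _ hf _ _ hg => ContinuousMap.Homotopic.comp hg hf) f g
  id_comp := by rintro X Y ⟨f⟩; rfl
  comp_id := by rintro X Y ⟨f⟩; rfl
  assoc := by rintro W X Y Z ⟨f⟩ ⟨g⟩ ⟨h⟩; rfl

/-- The homotopy class of a continuous map. -/
def homotopyClass {X Y : Hot.{u}} (f : X.space ⟶ Y.space) : X ⟶ Y :=
  Quotient.mk (homotopySetoid X Y) f.hom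

theorem homotopyClass_eq_iff {X Y : Hot.{u}} (f g : X.space ⟶ Y.space) :
    homotopyClass f = homotopyClass g ↔ ContinuousMap.Homotopic f.hom g.hom :=
  Quotient.eq (r := homotopySetoid X Y)

theorem homotopyClass_comp {X Y Z : Hot.{u}} (f : X.space ⟶ Y.space) (g : Y.space ⟶ Z.space) :
    homotopyClass f ≫ homotopyClass g = homotopyClass (f ≫ g) :=
  rfl

end Hot

/-- The homotopy category of connected spaces: the full subcategory of `Hot` on the (nonempty)
connected spaces. -/
abbrev HotConnected : Type (u + 1) :=
  ObjectProperty.FullSubcategory (fun X : Hot.{u} => ConnectedSpace X.space)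

/-! ### Classifying spaces of discrete groups -/

/-- The classifying space `BG` of a discrete group: the geometric realization of the nerve of `G`,
regarded as a category with one object. -/
def classifyingSpace (G : Type u) [Group G] : TopCat.{u} :=
  SSet.toTop.obj (nerve (SingleObj G))

/-- The map `Bφ : BG ⟶ BH` induced by a group homomorphism `φ : G →* H`. -/
def classifyingSpaceMap {G H : Type u} [Group G] [Group H] (φ : G →* H) :
    classifyingSpace G ⟶ classifyingSpace H :=
  SSet.toTop.map (nerveMap φ.toFunctor)

/-! ### Essentially constant permutations and the shift -/

/-- The group of essentially constant permutations of an ordinal `α`: the union inside the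
symmetric group of `α` of the symmetric groups of all `β < α`, where a permutation of
`β = {γ | γ < β}` is extended to `α` by the identity. The union is directed, so it is the supremum
of these subgroups, see `mem_essConstPerm`. -/
def essConstPerm (α : Ordinal.{u}) : Subgroup (Equiv.Perm α.ToType) :=
  ⨆ β : α.ToType, (Equiv.Perm.ofSubtype (p := fun γ : α.ToType => γ < β)).range

theorem mem_range_ofSubtype_iff {α : Ordinal.{u}} (β : α.ToType) (σ : Equiv.Perm α.ToType) :
    σ ∈ (Equiv.Perm.ofSubtype (p := fun γ : α.ToType => γ < β)).range ↔
      ∀ γ, β ≤ γ → σ γ = γ := by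
  constructor
  · rintro ⟨τ, rfl⟩ γ hγ
    exact Equiv.Perm.ofSubtype_apply_of_not_mem τ (not_lt.mpr hγ)
  · intro h
    have h₁ : ∀ γ, γ < β → σ γ < β := by
      intro γ hγ
      by_contra hc
      have h2 := h (σ γ) (not_lt.mp hc)
      exact hc ((σ.injective h2).symm ▸ hγ)
    have h₂ : ∀ γ, σ γ < β ↔ γ < β := by
      intro γ
      refine ⟨fun hγ => ?_, h₁ γ⟩
      by_contra hc
      rw [h γ (not_lt.mp hc)] at hγ
      exact hc hγ
    refine ⟨σ.subtypePerm h₂, Equiv.Perm.ofSubtype_subtypePerm h₂ ?_⟩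
    intro γ hγ
    by_contra hc
    exact hγ (h γ (not_lt.mp hc))

/-- A permutation is essentially constant iff it fixes all `γ ≥ β` for some `β < α`. -/
theorem mem_essConstPerm {α : Ordinal.{u}} [Nonempty α.ToType] (σ : Equiv.Perm α.ToType) :
    σ ∈ essConstPerm α ↔ ∃ β : α.ToType, ∀ γ, β ≤ γ → σ γ = γ := by
  have hd : Directed (· ≤ ·) (fun β : α.ToType =>
      (Equiv.Perm.ofSubtype (p := fun γ : α.ToType => γ < β)).range) := by
    apply Monotone.directed_le
    intro β β' h τ hτ
    rw [mem_range_ofSubtype_iff] at hτ ⊢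
    exact fun γ hγ => hτ γ (h.trans hγ)
  rw [essConstPerm, Subgroup.mem_iSup_of_directed hd]
  simp only [mem_range_ofSubtype_iff]

/-- The successor map `γ ↦ γ + 1` of an infinite cardinal, regarded as an initial ordinal. -/
def succEmbedding (α : Cardinal.{u}) (hα : Cardinal.aleph0 ≤ α) :
    α.ord.ToType ↪ α.ord.ToType :=
  haveI := Cardinal.noMaxOrder hα
  ⟨Order.succ, Order.succ_injective⟩

theorem viaEmbedding_mem_essConstPerm (α : Cardinal.{u}) (hα : Cardinal.aleph0 ≤ α)
    (σ : Equiv.Perm α.ord.ToType) (hσ : σ ∈ essConstPerm α.ord) :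
    Equiv.Perm.viaEmbeddingHom (succEmbedding α hα) σ ∈ essConstPerm α.ord := by
  have := Cardinal.noMaxOrder hα
  have : Nonempty α.ord.ToType := by
    rw [Ordinal.nonempty_toType_iff]
    intro h
    rw [Cardinal.ord_eq_zero] at h
    exact Cardinal.aleph0_ne_zero (le_antisymm (h ▸ hα) bot_le)
  rw [mem_essConstPerm] at hσ ⊢
  obtain ⟨β, hβ⟩ := hσ
  refine ⟨Order.succ β, fun γ hγ => ?_⟩
  rw [Equiv.Perm.viaEmbeddingHom_apply]
  by_cases h : γ ∈ Set.range (succEmbedding α hα)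
  · obtain ⟨γ', rfl⟩ := h
    rw [Equiv.Perm.viaEmbedding_apply, hβ γ' (Order.succ_le_succ_iff.mp hγ)]
  · exact Equiv.Perm.viaEmbedding_apply_of_notMem _ _ _ h

/-- The shift endomorphism `s` of the group of essentially constant permutations of an infinite
cardinal: `(s σ) (γ' + 1) = σ γ' + 1`, and `(s σ) γ = γ` if `γ` is not a successor (that is, if it
is zero or a limit ordinal), see `shift_apply_succ` and `shift_apply_of_not_succ`. -/
def shift (α : Cardinal.{u}) (hα : Cardinal.aleph0 ≤ α) :
    essConstPerm α.ord →* essConstPerm α.ord :=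
  ((Equiv.Perm.viaEmbeddingHom (succEmbedding α hα)).comp (essConstPerm α.ord).subtype).codRestrict
    (essConstPerm α.ord) (fun σ => viaEmbedding_mem_essConstPerm α hα σ.1 σ.2)

theorem shift_apply_succ (α : Cardinal.{u}) (hα : Cardinal.aleph0 ≤ α)
    (σ : essConstPerm α.ord) (γ : α.ord.ToType) :
    (shift α hα σ).1 (Order.succ γ) = Order.succ (σ.1 γ) :=
  Equiv.Perm.viaEmbedding_apply σ.1 (succEmbedding α hα) γ

theorem shift_apply_of_not_succ (α : Cardinal.{u}) (hα : Cardinal.aleph0 ≤ α)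
    (σ : essConstPerm α.ord) (γ : α.ord.ToType) (hγ : ∀ γ', γ ≠ Order.succ γ') :
    (shift α hα σ).1 γ = γ :=
  Equiv.Perm.viaEmbedding_apply_of_notMem σ.1 (succEmbedding α hα) γ
    (by rintro ⟨γ', rfl⟩; exact hγ γ' rfl)

/-- A regular cardinal `α` is *large* for `G` if it is larger than the cardinality of
`π₁(S, s₀)` for all `S ∈ G` and all `s₀ ∈ S`. -/
def IsLargeFor (α : Cardinal.{u}) (G : Set Hot.{u}) : Prop :=
  α.IsRegular ∧ ∀ S ∈ G, ∀ s₀ : S.space, Cardinal.mk (FundamentalGroup S.space s₀) < α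

end

/-!
The shift `s` of the group `Σ` of essentially constant permutations of a regular cardinal `α` is
not an inner automorphism, and not even surjective, since every `s σ` fixes zero. But it is
indistinguishable from an inner automorphism on small pieces: fewer than `α` elements of `Σ` are
all supported below some `β < α`, and on permutations of `β` the shift is conjugation by any `d`
in `Σ` which agrees with the successor map below `β` (`exists_shift_mul_eq`). A map `h` from a
space `S` whose fundamental groups have fewer than `α` elements sees only such a small piece in
every path component, so that `Bs ∘ h` is homotopic to `h` (`homotopic_classifyingSpaceMap_comp`).
On the other hand, a right homotopy inverse of `Bs` would force `s` to be surjective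
(`surjective_of_homotopic_id`).

Both statements about `Bs` are read off from the covering `EG → BG`, where `EG` is the realization
of the simplicial set of tuples in `G`. Maps between such spaces which come from functions between
the vertex sets are joined by straight-line homotopies, which are natural and therefore as
equivariant as the functions themselves (`ESpace.straightLine`). That `EG → BG` is a covering
(`ESpace.isQuotientCoveringMap_proj`) amounts to the action of `G` on `EG` being properly
discontinuous. For this, a point of `EG` is sent to a step function on `[0, 1)` with values in
`G`, whose step lengths are the barycentric coordinates; two step functions are compared by the
volume of the set where they differ, and nontrivial elements of `G` move every step function by
distance `1` (`ESpace.exists_nhds_smul_disjoint`).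

The homotopy between `Bs ∘ h` and `h` is assembled from the straight-line homotopies by lifting
`h` along paths in `S` (`IsQuotientCoveringMap.exists_continuousMap_of_monodromy_invariant`). This
needs `S` to be locally path connected, which holds for CW-complexes because local path
connectedness passes to colimits (`TopCat.CWComplex.locallyPathConnectedSpace`). Finally, the
realization of any simplicial set is a CW-complex (`nonempty_cwComplex_toTop`): Mathlib attaches
the nondegenerate simplices in the category of simplicial sets, and the realization of the pair
`(Δ[n], ∂Δ[n])` is identified with the disk and its boundary sphere.
-/

/-! ### Points of geometric realizations -/

noncomputable section

open Opposite Simplicial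

namespace SSet

variable {X Y : SSet.{u}}

/-- The point of the geometric realization with barycentric coordinates `t` in the simplex `σ`. -/
def point {n : SimplexCategory} (σ : X.obj (op n)) (t : _root_.stdSimplex ℝ (Fin (n.len + 1))) :
    SSet.toTop.obj X :=
  SSet.toTop.map (yonedaEquiv.symm σ) (n.toTopHomeo.symm t)

theorem continuous_point {n : SimplexCategory} (σ : X.obj (op n)) : Continuous (point σ) :=
  (SSet.toTop.map (yonedaEquiv.symm σ)).hom.continuous.comp n.toTopHomeo.symm.continuous

theorem toTop_map_point (f : X ⟶ Y) {n : SimplexCategory} (σ : X.obj (op n))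
    (t : _root_.stdSimplex ℝ (Fin (n.len + 1))) :
    SSet.toTop.map f (point σ t) = point (f.app _ σ) t := by
  rw [point, point, ← yonedaEquiv_symm_comp, Functor.map_comp]
  rfl

theorem point_map {m n : SimplexCategory} (θ : m ⟶ n) (σ : X.obj (op n))
    (t : _root_.stdSimplex ℝ (Fin (m.len + 1))) :
    point (X.map θ.op σ) t = point σ (stdSimplex.map θ t) := by
  rw [point, point, SimplexCategory.toTopHomeo_symm_naturality_apply,
    ← yonedaEquiv_symm_naturality_left, Functor.map_comp]
  rfl

/-- A map out of a geometric realization sends points of a simplex to the values of the singular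
simplex which corresponds to it under the adjunction. -/
theorem toSSetObjEquiv_homEquiv {Z : TopCat.{u}} (f : SSet.toTop.obj X ⟶ Z) {n : SimplexCategory}
    (σ : X.obj (op n)) (t : _root_.stdSimplex ℝ (Fin (n.len + 1))) :
    TopCat.toSSetObjEquiv _ _ ((sSetTopAdj.homEquiv X Z f).app (op n) σ) t = f (point σ t) := by
  rw [Adjunction.homEquiv_unit]
  change f ((((sSetTopAdj.unit.app X).app (op n) σ).down).hom (ULift.up t)) = _
  rw [sSetTopAdj_unit_app_app_down]
  rfl

/-- A map out of a geometric realization is determined by its values on the points of simplices. -/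
theorem toTop_hom_ext {Z : TopCat.{u}} {f g : SSet.toTop.obj X ⟶ Z}
    (h : ∀ (n : SimplexCategory) (σ : X.obj (op n)) (t), f (point σ t) = g (point σ t)) :
    f = g := by
  apply (sSetTopAdj.homEquiv _ _).injective
  ext n σ
  apply (TopCat.toSSetObjEquiv _ _).injective
  ext t
  exact (toSSetObjEquiv_homEquiv f (n := n.unop) σ t).trans
    ((h n.unop σ t).trans (toSSetObjEquiv_homEquiv g (n := n.unop) σ t).symm)

/-- The continuous map out of the geometric realization given by a compatible family of continuous
maps on the topological simplices. -/
def toTopDesc {Z : Type u} [TopologicalSpace Z]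
    (c : ∀ n : SimplexCategory, X.obj (op n) → C(_root_.stdSimplex ℝ (Fin (n.len + 1)), Z))
    (hc : ∀ (m n : SimplexCategory) (θ : m ⟶ n) (σ : X.obj (op n)) (t),
      c m (X.map θ.op σ) t = c n σ (stdSimplex.map θ t)) :
    C(SSet.toTop.obj X, Z) :=
  ((sSetTopAdj.homEquiv X (TopCat.of Z)).symm
    { app n := ↾fun σ => (TopCat.toSSetObjEquiv (TopCat.of Z) n).symm (c n.unop σ)
      naturality m n θ := by
        ext σ
        apply (TopCat.toSSetObjEquiv _ _).injective
        ext t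
        exact hc _ _ θ.unop σ t }).hom

theorem toTopDesc_point {Z : Type u} [TopologicalSpace Z]
    (c : ∀ n : SimplexCategory, X.obj (op n) → C(_root_.stdSimplex ℝ (Fin (n.len + 1)), Z))
    (hc : ∀ (m n : SimplexCategory) (θ : m ⟶ n) (σ : X.obj (op n)) (t),
      c m (X.map θ.op σ) t = c n σ (stdSimplex.map θ t)) {n : SimplexCategory}
    (σ : X.obj (op n)) (t : _root_.stdSimplex ℝ (Fin (n.len + 1))) :
    toTopDesc c hc (point σ t) = c n σ t := by
  rw [toTopDesc]
  refine (toSSetObjEquiv_homEquiv (Z := TopCat.of Z) _ σ t).symm.trans ?_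
  rw [Equiv.apply_symm_apply]
  rfl

/-- Every point of a geometric realization lies in a simplex. The proof compares the indicator of
the set of such points with the constant map, both into an indiscrete space. -/
theorem exists_point (x : SSet.toTop.obj X) :
    ∃ (n : SimplexCategory) (σ : X.obj (op n)) (t : _), point σ t = x := by
  let Z : Type u := ULift Prop
  let _ : TopologicalSpace Z := ⊤
  let f : SSet.toTop.obj X ⟶ TopCat.of Z :=
    TopCat.ofHom ⟨fun x => ⟨∃ (n : SimplexCategory) (σ : X.obj (op n)) (t : _), point σ t = x⟩,
      continuous_top⟩
  let g : SSet.toTop.obj X ⟶ TopCat.of Z := TopCat.ofHom ⟨fun x => ⟨True⟩, continuous_top⟩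
  have h : f = g := toTop_hom_ext fun n σ t =>
    ULift.ext _ _ (propext ⟨fun _ => trivial, fun _ => ⟨n, σ, t, rfl⟩⟩)
  have h' := congrArg (fun k => (k x).down) h
  exact cast h'.symm trivial

end SSet

end

/-! ### Realizations of subcomplexes of standard simplices -/

noncomputable section

open Opposite Simplicial

namespace stdSimplex

theorem map_apply {m n : Type*} [Fintype m] [Fintype n] [DecidableEq n] (f : m → n)
    (t : stdSimplex ℝ m) (j : n) :
    stdSimplex.map f t j = ∑ i with f i = j, t i := by
  rw [stdSimplex.map_coe, FunOnFinite.linearMap_apply_apply]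

theorem map_apply_pos_iff {m n : Type*} [Fintype m] [Fintype n] (f : m → n)
    {t : stdSimplex ℝ m} (ht : ∀ i, 0 < t i) (j : n) :
    0 < stdSimplex.map f t j ↔ j ∈ Set.range f := by
  classical
  rw [map_apply, Finset.sum_pos_iff_of_nonneg fun i _ => stdSimplex.zero_le t i]
  constructor
  · rintro ⟨i, hi, -⟩
    exact ⟨i, (Finset.mem_filter.1 hi).2⟩
  · rintro ⟨i, rfl⟩
    exact ⟨i, by simp, ht i⟩

theorem map_apply_of_injective {m n : Type*} [Fintype m] [Fintype n] {f : m → n}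
    (hf : Function.Injective f) (t : stdSimplex ℝ m) (i : m) : stdSimplex.map f t (f i) = t i := by
  classical
  rw [map_apply]
  refine Finset.sum_eq_single i (fun j hj hji => ?_) (fun hi => ?_)
  · exact absurd (hf (Finset.mem_filter.1 hj).2) hji
  · simp at hi

theorem map_injective {m n : Type*} [Fintype m] [Fintype n] {f : m → n}
    (hf : Function.Injective f) : Function.Injective (stdSimplex.map (S := ℝ) f) := by
  intro t t' h
  ext i
  rw [← map_apply_of_injective hf t, h, map_apply_of_injective hf]

/-- A point of a simplex with a vanishing coordinate lies in the opposite face. -/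
theorem exists_map_succAbove {n : ℕ} {t : stdSimplex ℝ (Fin (n + 2))} {i : Fin (n + 2)}
    (hi : t i = 0) : ∃ t' : stdSimplex ℝ (Fin (n + 1)), stdSimplex.map i.succAbove t' = t := by
  have hs : ∑ j : Fin (n + 1), t (i.succAbove j) = 1 := by
    have h := stdSimplex.sum_eq_one t
    rwa [Fin.sum_univ_succAbove _ i, hi, zero_add] at h
  let t' : stdSimplex ℝ (Fin (n + 1)) :=
    ⟨fun j => t (i.succAbove j), fun j => stdSimplex.zero_le t _, hs⟩
  refine ⟨t', ?_⟩
  ext k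
  obtain rfl | ⟨j, rfl⟩ := Fin.eq_self_or_eq_succAbove i k
  · rw [map_apply, hi]
    apply Finset.sum_eq_zero
    intro j hj
    exact absurd (Finset.mem_filter.1 hj).2 (Fin.succAbove_ne _ _)
  · exact map_apply_of_injective Fin.succAbove_right_injective t' j

theorem apply_eq_one (t : stdSimplex ℝ (Fin 1)) (i : Fin 1) : t i = 1 := by
  have h := stdSimplex.sum_eq_one t
  rwa [Fin.sum_univ_one, Subsingleton.elim 0 i] at h

end stdSimplex

namespace SSet

variable {X : SSet.{u}}

/-- Every point of a geometric realization is an interior point of some simplex: pass to a face as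
long as a barycentric coordinate vanishes. -/
theorem exists_point_interior (x : SSet.toTop.obj X) :
    ∃ (n : ℕ) (σ : X _⦋n⦌) (t : _root_.stdSimplex ℝ (Fin (n + 1))),
      (∀ i, 0 < t i) ∧ point (n := ⦋n⦌) σ t = x := by
  obtain ⟨n, σ, t, rfl⟩ := exists_point x
  induction n using SimplexCategory.rec with | _ n
  change X _⦋n⦌ at σ
  change _root_.stdSimplex ℝ (Fin (n + 1)) at t
  induction n with
  | zero =>
    refine ⟨0, σ, t, fun i => ?_, rfl⟩
    rw [_root_.stdSimplex.apply_eq_one]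
    exact one_pos
  | succ n ih =>
    by_cases ht : ∀ i, 0 < t i
    · exact ⟨_, σ, t, ht, rfl⟩
    · push Not at ht
      obtain ⟨i, hi⟩ := ht
      obtain ⟨t', rfl⟩ :=
        stdSimplex.exists_map_succAbove (le_antisymm hi (_root_.stdSimplex.zero_le t i))
      obtain ⟨m, τ, s, hs, h⟩ := ih (X.δ i σ) t'
      exact ⟨m, τ, s, hs, h.trans (point_map (SimplexCategory.δ i) σ t')⟩

/-- Every point of a geometric realization is an interior point of a nondegenerate simplex. -/
theorem exists_point_nonDegenerate (x : SSet.toTop.obj X) :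
    ∃ (n : ℕ) (σ : X.nonDegenerate n) (t : _root_.stdSimplex ℝ (Fin (n + 1))),
      (∀ i, 0 < t i) ∧ point (n := ⦋n⦌) σ.1 t = x := by
  obtain ⟨n, σ, t, ht, rfl⟩ := exists_point_interior x
  obtain ⟨m, f, hf, τ, rfl⟩ := X.exists_nonDegenerate σ
  refine ⟨m, τ, stdSimplex.map f t, fun i => ?_, (point_map f τ.1 t).symm⟩
  rw [stdSimplex.map_apply_pos_iff _ ht]
  exact SimplexCategory.epi_iff_surjective.1 hf i

/-- The barycentric coordinates of a point of the realization of a standard simplex. -/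
theorem toTopHomeo_point {k n : SimplexCategory} (τ : (stdSimplex.{u}.obj n).obj (op k))
    (t : _root_.stdSimplex ℝ (Fin (k.len + 1))) :
    n.toTopHomeo (point τ t) = _root_.stdSimplex.map (stdSimplex.objEquiv τ) t := by
  obtain ⟨f, rfl⟩ := stdSimplex.objEquiv.symm.surjective τ
  rw [point, Equiv.apply_symm_apply]
  have : yonedaEquiv.symm (stdSimplex.objEquiv.symm f) = stdSimplex.{u}.map f := by
    rw [Equiv.symm_apply_eq, yonedaEquiv_map]
  erw [this]
  rw [SimplexCategory.toTopHomeo_naturality_apply, Homeomorph.apply_symm_apply]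

/-- The barycentric coordinates of the points of the realization of a subcomplex of a standard
simplex. -/
noncomputable def subcomplexToTop {n : ℕ} (A : (Δ[n] : SSet.{u}).Subcomplex) :
    C(SSet.toTop.obj (A : SSet.{u}), _root_.stdSimplex ℝ (Fin (n + 1))) :=
  ⟨fun x => SimplexCategory.toTopHomeo ⦋n⦌ (SSet.toTop.map A.ι x),
    (SimplexCategory.toTopHomeo ⦋n⦌).continuous.comp (SSet.toTop.map A.ι).hom.continuous⟩

theorem subcomplexToTop_point {n : ℕ} (A : (Δ[n] : SSet.{u}).Subcomplex) {k : SimplexCategory}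
    (τ : (A : SSet.{u}).obj (op k)) (t : _root_.stdSimplex ℝ (Fin (k.len + 1))) :
    subcomplexToTop A (point τ t) = _root_.stdSimplex.map (stdSimplex.objEquiv τ.1) t := by
  change SimplexCategory.toTopHomeo ⦋n⦌ (SSet.toTop.map A.ι (point τ t)) = _
  rw [toTop_map_point, toTopHomeo_point]
  rfl

/-- A point of the realization is recovered from its barycentric coordinates: their support
determines the nondegenerate simplex which contains the point in its interior. -/
theorem subcomplexToTop_injective {n : ℕ} (A : (Δ[n] : SSet.{u}).Subcomplex) :
    Function.Injective (subcomplexToTop A) := by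
  intro x y hxy
  obtain ⟨k, ⟨σ, hσ⟩, t, ht, rfl⟩ := exists_point_nonDegenerate x
  obtain ⟨l, ⟨τ, hτ⟩, s, hs, rfl⟩ := exists_point_nonDegenerate y
  have hσ : StrictMono (stdSimplex.objEquiv σ.1) :=
    (stdSimplex.mem_nonDegenerate_iff_strictMono _).1 ((A.mem_nonDegenerate_iff σ).1 hσ)
  have hτ : StrictMono (stdSimplex.objEquiv τ.1) :=
    (stdSimplex.mem_nonDegenerate_iff_strictMono _).1 ((A.mem_nonDegenerate_iff τ).1 hτ)
  rw [subcomplexToTop_point, subcomplexToTop_point] at hxy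
  have hr : Set.range (stdSimplex.objEquiv σ.1) = Set.range (stdSimplex.objEquiv τ.1) := by
    ext j
    rw [← stdSimplex.map_apply_pos_iff _ ht, ← stdSimplex.map_apply_pos_iff _ hs, hxy]
  -- an order embedding of a finite ordinal is determined by its range
  have hkl : k = l := by
    have h := congrArg Set.ncard hr
    rw [← Set.image_univ, ← Set.image_univ, Set.ncard_image_of_injective _ hσ.injective,
      Set.ncard_image_of_injective _ hτ.injective] at h
    simpa using h
  subst hkl
  have h : σ = τ := by
    apply Subtype.ext
    apply stdSimplex.objEquiv.injective
    apply SimplexCategory.Hom.ext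
    apply OrderHom.ext
    exact (hσ.range_inj hτ).1 hr
  subst h
  rw [stdSimplex.map_injective hσ.injective hxy]

theorem range_subcomplexToTop_boundary (n : ℕ) :
    Set.range (subcomplexToTop (∂Δ[n] : (Δ[n] : SSet.{u}).Subcomplex)) = {t | ∃ i, t i = 0} := by
  ext t
  constructor
  · rintro ⟨x, rfl⟩
    obtain ⟨k, τ, t, ht, rfl⟩ := exists_point_interior x
    obtain ⟨i, hi⟩ := (mem_boundary_iff_notMem_range _).1 τ.2
    refine ⟨i, ?_⟩
    rw [subcomplexToTop_point]
    refine le_antisymm (not_lt.1 fun h => hi ?_) (stdSimplex.zero_le _ _)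
    exact (stdSimplex.map_apply_pos_iff _ ht _).1 h
  · rintro ⟨i, hi⟩
    cases n with
    | zero =>
      exact absurd ((_root_.stdSimplex.apply_eq_one t i).symm.trans hi) one_ne_zero
    | succ n =>
      obtain ⟨t', rfl⟩ := stdSimplex.exists_map_succAbove hi
      let τ : (∂Δ[n + 1] : SSet.{u}) _⦋n⦌ :=
        ⟨stdSimplex.objEquiv.symm (SimplexCategory.δ i),
          (mem_boundary_iff_notMem_range _).2 ⟨i, by
            rintro ⟨j, hj⟩
            exact Fin.succAbove_ne i j hj⟩⟩
      exact ⟨point τ t', subcomplexToTop_point _ _ _⟩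

theorem compactSpace_boundary (n : ℕ) :
    CompactSpace (SSet.toTop.obj (∂Δ[n] : SSet.{u})) := by
  cases n with
  | zero =>
    have : IsEmpty (SSet.toTop.obj (∂Δ[0] : SSet.{u})) := by
      refine ⟨fun x => ?_⟩
      obtain ⟨i, hi⟩ := (range_subcomplexToTop_boundary.{u} 0).le ⟨x, rfl⟩
      exact one_ne_zero ((_root_.stdSimplex.apply_eq_one _ i).symm.trans hi)
    infer_instance
  | succ n =>
    let τ (i : Fin (n + 2)) : (∂Δ[n + 1] : SSet.{u}) _⦋n⦌ :=
        ⟨stdSimplex.objEquiv.symm (SimplexCategory.δ i),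
          (mem_boundary_iff_notMem_range _).2 ⟨i, by
            rintro ⟨j, hj⟩
            exact Fin.succAbove_ne i j hj⟩⟩
    have h : (⋃ i, Set.range (point (n := ⦋n⦌) (τ i))) = Set.univ := by
      refine Set.eq_univ_of_forall fun x => ?_
      obtain ⟨i, hi⟩ := (range_subcomplexToTop_boundary.{u} (n + 1)).le ⟨x, rfl⟩
      obtain ⟨t', ht'⟩ := stdSimplex.exists_map_succAbove hi
      refine Set.mem_iUnion.2 ⟨i, t', subcomplexToTop_injective _ ?_⟩
      rw [subcomplexToTop_point, ← ht']
      rfl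
    rw [← isCompact_univ_iff, ← h]
    exact isCompact_iUnion fun i => isCompact_range (continuous_point _)

end SSet

end

/-! ### Geometric realizations are CW-complexes -/

noncomputable section

open Opposite Simplicial HomotopicalAlgebra Limits TopCat

/-- The projection of the standard simplex forgetting the first barycentric coordinate. -/
def simplexChart (n : ℕ) (t : stdSimplex ℝ (Fin (n + 1))) : EuclideanSpace ℝ (Fin n) :=
  WithLp.toLp 2 fun i => t i.succ

theorem continuous_simplexChart (n : ℕ) : Continuous (simplexChart n) := by
  refine (PiLp.continuous_toLp 2 _).comp (continuous_pi fun i => ?_)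
  exact (continuous_apply _).comp continuous_subtype_val

theorem simplexChart_injective (n : ℕ) : Function.Injective (simplexChart n) := by
  intro t t' h
  have hs (i : Fin n) : t i.succ = t' i.succ :=
    congrArg (fun v : EuclideanSpace ℝ (Fin n) => v i) h
  have h0 : t 0 = t' 0 := by
    have h1 := stdSimplex.sum_eq_one t
    have h2 := stdSimplex.sum_eq_one t'
    rw [Fin.sum_univ_succ] at h1 h2
    simp only [hs] at h1
    linarith
  ext i
  exact Fin.cases h0 hs i

/-- The full-dimensional simplex in `ℝⁿ`. -/
def solidSimplex (n : ℕ) : Set (EuclideanSpace ℝ (Fin n)) :=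
  {y | (∀ i, 0 ≤ y i) ∧ ∑ i, y i ≤ 1}

theorem range_simplexChart (n : ℕ) : Set.range (simplexChart n) = solidSimplex n := by
  ext y
  constructor
  · rintro ⟨t, rfl⟩
    refine ⟨fun i => stdSimplex.zero_le t _, ?_⟩
    have h1 := stdSimplex.sum_eq_one t
    rw [Fin.sum_univ_succ] at h1
    have := stdSimplex.zero_le t 0
    simp only [simplexChart]
    linarith
  · rintro ⟨h0, h1⟩
    refine ⟨⟨Fin.cons (1 - ∑ i, y i) y, ?_, ?_⟩, ?_⟩
    · intro i
      refine Fin.cases ?_ (fun j => ?_) i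
      · simpa using h1
      · simpa using h0 j
    · rw [Fin.sum_univ_succ]
      simp
    · ext i
      rfl

theorem interior_solidSimplex (n : ℕ) :
    interior (solidSimplex n) = {y | (∀ i, 0 < y i) ∧ ∑ i, y i < 1} := by
  apply Set.Subset.antisymm
  · intro y hy
    obtain ⟨ε, hε, hb⟩ := Metric.isOpen_iff.1 isOpen_interior y hy
    have key (v : EuclideanSpace ℝ (Fin n)) (hv : ‖v‖ < ε) : y + v ∈ solidSimplex n :=
      interior_subset (hb (by simpa [Metric.mem_ball, dist_eq_norm] using hv))
    have hn (i : Fin n) (c : ℝ) : ‖EuclideanSpace.single i c‖ = |c| := by simp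
    -- move `y` by `ε / 2` against a coordinate direction
    have hpos : ∀ i, 0 < y i := by
      intro i
      have h := (key (EuclideanSpace.single i (-(ε / 2)))
        (by rw [hn, abs_neg, abs_of_pos (half_pos hε)]; linarith)).1 i
      simp at h
      linarith
    refine ⟨hpos, ?_⟩
    cases n with
    | zero => simp
    | succ n =>
      -- move `y` by `ε / 2` along a coordinate direction
      have h := (key (EuclideanSpace.single 0 (ε / 2))
        (by rw [hn, abs_of_pos (half_pos hε)]; linarith)).2
      simp [Finset.sum_add_distrib] at h
      linarith
  · refine interior_maximal (fun y hy => ⟨fun i => (hy.1 i).le, hy.2.le⟩) ?_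
    have h1 (i : Fin n) : Continuous fun y : EuclideanSpace ℝ (Fin n) => y i := by fun_prop
    rw [Set.ofPred_and, Set.ofPred_forall]
    exact (isOpen_iInter_of_finite fun i => isOpen_lt continuous_const (h1 i)).inter
      (isOpen_lt (continuous_finsetSum _ fun i _ => h1 i) continuous_const)

/-- There is a homeomorphism from the standard simplex to the unit ball which identifies the
boundary with the sphere. It is stated as a continuous injection with values in the Euclidean
space. -/
theorem exists_simplex_ball (n : ℕ) :
    ∃ g : stdSimplex ℝ (Fin (n + 1)) → EuclideanSpace ℝ (Fin n), Continuous g ∧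
      Function.Injective g ∧ Set.range g = Metric.closedBall 0 1 ∧
      ∀ t, g t ∈ Metric.sphere 0 1 ↔ ∃ i, t i = 0 := by
  have hcomp : IsCompact (solidSimplex n) := by
    rw [← range_simplexChart]
    exact isCompact_range (continuous_simplexChart n)
  have hconv : Convex ℝ (solidSimplex n) := by
    intro x hx y hy a b ha hb hab
    refine ⟨fun i => ?_, ?_⟩
    · have := hx.1 i
      have := hy.1 i
      simp only [PiLp.add_apply, PiLp.smul_apply, smul_eq_mul]
      positivity
    · simp only [PiLp.add_apply, PiLp.smul_apply, smul_eq_mul, Finset.sum_add_distrib,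
        ← Finset.mul_sum]
      calc _ ≤ a * 1 + b * 1 := by gcongr; exacts [hx.2, hy.2]
        _ = 1 := by linarith
  have hne : (interior (solidSimplex n)).Nonempty := by
    rw [interior_solidSimplex]
    refine ⟨WithLp.toLp 2 fun _ => (1 / (n + 1) : ℝ), fun i => ?_, ?_⟩
    · simp only
      positivity
    · simp only [Finset.sum_const, Finset.card_univ, Fintype.card_fin, nsmul_eq_mul]
      rw [mul_one_div, div_lt_one (by positivity)]
      linarith
  obtain ⟨h, -, hcl, hfr⟩ :=
    exists_homeomorph_image_interior_closure_frontier_eq_unitBall hconv hne hcomp.isBounded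
  refine ⟨h ∘ simplexChart n, h.continuous.comp (continuous_simplexChart n),
    h.injective.comp (simplexChart_injective n), ?_, fun t => ?_⟩
  · rw [Set.range_comp, range_simplexChart, ← hcl, hcomp.isClosed.closure_eq]
  · have ht : simplexChart n t ∈ solidSimplex n := by
      rw [← range_simplexChart]
      exact ⟨t, rfl⟩
    rw [← hfr, Function.comp_apply, h.injective.mem_set_image, frontier, hcomp.isClosed.closure_eq,
      Set.mem_sdiff, interior_solidSimplex]
    have h1 := stdSimplex.sum_eq_one t
    rw [Fin.sum_univ_succ] at h1
    constructor
    · rintro ⟨-, hni⟩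
      by_contra hc
      push Not at hc
      have hpos (i) : 0 < t i := lt_of_le_of_ne (stdSimplex.zero_le t i) (hc i).symm
      refine hni ⟨fun i => hpos _, ?_⟩
      have := hpos 0
      simp only [simplexChart]
      linarith
    · rintro ⟨i, hi⟩
      refine ⟨ht, fun hint => ?_⟩
      revert hi
      refine Fin.cases (fun hi => ?_) (fun j hj => ?_) i
      · have := hint.2
        simp only [simplexChart] at this
        linarith
      · exact (hint.1 j).ne' hj

/-- The realization of the boundary inclusion of the standard simplex is isomorphic to the
inclusion of the boundary of the disk. -/
theorem nonempty_boundary_iso_disk (n : ℕ) :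
    Nonempty (Arrow.mk (SSet.toTop.map (∂Δ[n] : (Δ[n] : SSet.{u}).Subcomplex).ι) ≅
      Arrow.mk (diskBoundaryInclusion.{u} n)) := by
  obtain ⟨g, hg, hinj, hrange, hsphere⟩ := exists_simplex_ball n
  have := SSet.compactSpace_boundary.{u} n
  have : CompactSpace (SSet.toTop.obj Δ[n] : TopCat.{u}) :=
    (SimplexCategory.toTopHomeo ⦋n⦌).symm.compactSpace
  -- both comparison maps are continuous bijections from compact to Hausdorff spaces
  let eR : SSet.toTop.obj (Δ[n] : SSet.{u}) → 𝔻 n := fun x =>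
    ⟨g (SimplexCategory.toTopHomeo ⦋n⦌ x), hrange.le ⟨_, rfl⟩⟩
  have heR : Continuous eR := continuous_uliftUp.comp
    ((hg.comp (SimplexCategory.toTopHomeo ⦋n⦌).continuous).subtype_mk _)
  have hbR : Function.Bijective eR := by
    constructor
    · intro x y h
      exact (SimplexCategory.toTopHomeo ⦋n⦌).injective
        (hinj (congrArg (fun z : 𝔻 n => z.down.1) h))
    · rintro ⟨z, hz⟩
      obtain ⟨t, rfl⟩ := hrange.ge hz
      exact ⟨(SimplexCategory.toTopHomeo ⦋n⦌).symm t,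
        ULift.ext _ _ (Subtype.ext (congrArg g (Homeomorph.apply_symm_apply _ t)))⟩
  let j := SSet.subcomplexToTop (∂Δ[n] : (Δ[n] : SSet.{u}).Subcomplex)
  have hj (t) : t ∈ Set.range j ↔ ∃ i, t i = 0 := by
    rw [SSet.range_subcomplexToTop_boundary]
    rfl
  let eL : SSet.toTop.obj (∂Δ[n] : SSet.{u}) → ∂𝔻 n := fun x =>
    ⟨g (j x), (hsphere _).2 ((hj _).1 ⟨x, rfl⟩)⟩
  have heL : Continuous eL := continuous_uliftUp.comp ((hg.comp j.continuous).subtype_mk _)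
  have hbL : Function.Bijective eL := by
    constructor
    · intro x y h
      exact SSet.subcomplexToTop_injective _ (hinj (congrArg (fun z : ∂𝔻 n => z.down.1) h))
    · rintro ⟨z, hz⟩
      obtain ⟨t, rfl⟩ := hrange.ge (Metric.sphere_subset_closedBall hz)
      obtain ⟨x, rfl⟩ := (hj t).2 ((hsphere t).1 hz)
      exact ⟨x, rfl⟩
  have : T2Space (𝔻 n) := inferInstanceAs (T2Space (ULift _))
  have : T2Space (∂𝔻 n) := inferInstanceAs (T2Space (ULift _))
  let hR := Continuous.homeoOfEquivCompactToT2 (f := Equiv.ofBijective eR hbR) heR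
  let hL := Continuous.homeoOfEquivCompactToT2 (f := Equiv.ofBijective eL hbL) heL
  refine ⟨Arrow.isoMk (TopCat.isoOfHomeo hL) (TopCat.isoOfHomeo hR) ?_⟩
  ext x
  rfl

/-- The geometric realization of a simplicial set is a CW-complex, with one cell for each
nondegenerate simplex. -/
theorem nonempty_cwComplex_toTop (X : SSet.{u}) : Nonempty (CWComplex (SSet.toTop.obj X)) := by
  let c := SSet.relativeCellComplex X
  let e : Arrow.mk (SSet.toTop.map (Subfunctor.ι ⊥ : _ ⟶ X)) ≅
      Arrow.mk (initial.to (SSet.toTop.obj X)) :=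
    Arrow.isoMk ((IsInitial.isInitialObj SSet.toTop _ SSet.Subcomplex.isInitialBot).uniqueUpToIso
      initialIsInitial) (Iso.refl _)
      ((IsInitial.isInitialObj SSet.toTop _ SSet.Subcomplex.isInitialBot).hom_ext _ _)
  have : PreservesWellOrderContinuousOfShape ℕ SSet.toTop.{u} :=
    ⟨fun _ _ => inferInstance⟩
  let c' := (c.toTransfiniteCompositionOfShape.map SSet.toTop).ofArrowIso e
  refine ⟨{ c' with attachCells := fun n hn => ?_ }⟩
  let a := c.attachCells n hn
  let a' : AttachCells (fun _ : Unit => SSet.toTop.map (∂Δ[n] : (Δ[n] : SSet.{u}).Subcomplex).ι)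
      (SSet.toTop.map (c.F.map (homOfLE (Order.le_succ n)))) :=
    { ι := a.ι
      π := a.π
      cofan₁ := Cofan.mk _ fun i => SSet.toTop.map (a.cofan₁.inj i)
      cofan₂ := Cofan.mk _ fun i => SSet.toTop.map (a.cofan₂.inj i)
      isColimit₁ := isColimitCofanMkObjOfIsColimit SSet.toTop _ _ a.isColimit₁
      isColimit₂ := isColimitCofanMkObjOfIsColimit SSet.toTop _ _ a.isColimit₂
      m := SSet.toTop.map a.m
      hm := fun i => by
        simp only [Cofan.mk_pt, cofan_mk_inj]
        rw [← Functor.map_comp, a.hm, Functor.map_comp]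
      g₁ := SSet.toTop.map a.g₁
      g₂ := SSet.toTop.map a.g₂
      isPushout := a.isPushout.map SSet.toTop }
  exact a'.reindexCellTypes _ id fun _ => (nonempty_boundary_iso_disk n).some

end

/-! ### The spaces `EA` and straight-line homotopies -/

noncomputable section

open Opposite Simplicial unitInterval

namespace stdSimplex

/-- The point `(1 - u) t` on the front face and `u t` on the back face of the join of a simplex
with itself. -/
noncomputable def join {n : ℕ} (t : stdSimplex ℝ (Fin n)) (u : I) : stdSimplex ℝ (Fin (n + n)) :=
  ⟨Fin.append (fun i => (1 - u) * t i) (fun i => u * t i), by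
    intro i
    refine Fin.addCases (fun j => ?_) (fun j => ?_) i
    · rw [Fin.append_left]
      exact mul_nonneg (sub_nonneg.2 u.2.2) (stdSimplex.zero_le t j)
    · rw [Fin.append_right]
      exact mul_nonneg u.2.1 (stdSimplex.zero_le t j), by
    simp only [Fin.sum_univ_add, Fin.append_left, Fin.append_right, ← Finset.mul_sum,
      stdSimplex.sum_eq_one]
    ring⟩

theorem join_castAdd {n : ℕ} (t : stdSimplex ℝ (Fin n)) (u : I) (i : Fin n) :
    join t u (Fin.castAdd n i) = (1 - u) * t i :=
  Fin.append_left (fun i => (1 - (u : ℝ)) * t i) (fun i => (u : ℝ) * t i) i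

theorem join_natAdd {n : ℕ} (t : stdSimplex ℝ (Fin n)) (u : I) (i : Fin n) :
    join t u (Fin.natAdd n i) = u * t i :=
  Fin.append_right (fun i => (1 - (u : ℝ)) * t i) (fun i => (u : ℝ) * t i) i

theorem continuous_join (n : ℕ) :
    Continuous fun p : stdSimplex ℝ (Fin n) × I => join p.1 p.2 := by
  have h (i : Fin n) : Continuous fun p : stdSimplex ℝ (Fin n) × I => p.1 i :=
    (continuous_apply i).comp (continuous_subtype_val.comp continuous_fst)
  have h' : Continuous fun p : stdSimplex ℝ (Fin n) × I => (p.2 : ℝ) :=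
    continuous_subtype_val.comp continuous_snd
  refine Continuous.subtype_mk (continuous_pi fun i => ?_) _
  refine Fin.addCases (fun j => ?_) (fun j => ?_) i
  · simp only [Fin.append_left]
    exact (continuous_const.sub h').mul (h j)
  · simp only [Fin.append_right]
    exact h'.mul (h j)

theorem map_apply_of_notMem_range {m n : Type*} [Fintype m] [Fintype n] (f : m → n)
    (t : stdSimplex ℝ m) {j : n} (hj : j ∉ Set.range f) : stdSimplex.map f t j = 0 := by
  classical
  rw [map_apply]
  exact Finset.sum_eq_zero fun i hi => absurd ⟨i, (Finset.mem_filter.1 hi).2⟩ hj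

end stdSimplex

theorem Fin.castAdd_ne_natAdd {m n : ℕ} (i : Fin m) (j : Fin n) :
    Fin.castAdd n i ≠ Fin.natAdd m j := by
  intro h
  have h' := congrArg Fin.val h
  simp only [Fin.val_castAdd, Fin.val_natAdd] at h'
  omega

namespace stdSimplex

theorem join_zero {n : ℕ} (t : stdSimplex ℝ (Fin n)) :
    join t 0 = stdSimplex.map (Fin.castAdd n) t := by
  ext i
  refine Fin.addCases (fun j => ?_) (fun j => ?_) i
  · rw [join_castAdd, map_apply_of_injective (Fin.castAdd_injective n n)]
    simp
  · rw [join_natAdd, map_apply_of_notMem_range]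
    · simp
    · rintro ⟨k, hk⟩
      exact Fin.castAdd_ne_natAdd _ _ hk

theorem join_one {n : ℕ} (t : stdSimplex ℝ (Fin n)) :
    join t 1 = stdSimplex.map (Fin.natAdd n) t := by
  ext i
  refine Fin.addCases (fun j => ?_) (fun j => ?_) i
  · rw [join_castAdd, map_apply_of_notMem_range]
    · simp
    · rintro ⟨k, hk⟩
      exact Fin.castAdd_ne_natAdd _ _ hk.symm
  · rw [join_natAdd, map_apply_of_injective (Fin.natAdd_injective n n)]
    simp

/-- The map of joins induced by a map on both factors. -/
def _root_.Fin.joinMap {m n : ℕ} (f : Fin m → Fin n) : Fin (m + m) → Fin (n + n) :=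
  Fin.addCases (fun i => Fin.castAdd n (f i)) (fun i => Fin.natAdd n (f i))

theorem _root_.Fin.joinMap_castAdd {m n : ℕ} (f : Fin m → Fin n) (i : Fin m) :
    Fin.joinMap f (Fin.castAdd m i) = Fin.castAdd n (f i) := Fin.addCases_left i

theorem _root_.Fin.joinMap_natAdd {m n : ℕ} (f : Fin m → Fin n) (i : Fin m) :
    Fin.joinMap f (Fin.natAdd m i) = Fin.natAdd n (f i) := Fin.addCases_right i

theorem _root_.Fin.monotone_joinMap {m n : ℕ} {f : Fin m → Fin n} (hf : Monotone f) :
    Monotone (Fin.joinMap f) := by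
  intro i j
  refine Fin.addCases (fun i => ?_) (fun i => ?_) i <;>
    refine Fin.addCases (fun j => ?_) (fun j => ?_) j <;> intro h <;>
    simp only [Fin.joinMap_castAdd, Fin.joinMap_natAdd, Fin.le_def, Fin.val_castAdd,
      Fin.val_natAdd] at h ⊢
  · exact hf h
  · omega
  · omega
  · have := hf (Fin.le_def.2 (Nat.le_of_add_le_add_left h))
    rw [Fin.le_def] at this
    omega

theorem map_joinMap {m n : ℕ} (f : Fin m → Fin n) (t : stdSimplex ℝ (Fin m)) (u : I) :
    stdSimplex.map (Fin.joinMap f) (join t u) = join (stdSimplex.map f t) u := by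
  ext i
  rw [map_apply, Finset.sum_filter, Fin.sum_univ_add]
  simp only [Fin.joinMap_castAdd, Fin.joinMap_natAdd, join_castAdd, join_natAdd]
  refine Fin.addCases (fun j => ?_) (fun j => ?_) i
  · simp only [join_castAdd, map_apply, Fin.castAdd_inj, (Fin.castAdd_ne_natAdd _ _).symm,
      Finset.mul_sum, Finset.sum_filter, if_false, Finset.sum_const_zero, add_zero, mul_ite,
      mul_zero]
  · simp only [join_natAdd, map_apply, Fin.natAdd_inj, Fin.castAdd_ne_natAdd, Finset.mul_sum,
      Finset.sum_filter, if_false, Finset.sum_const_zero, zero_add, mul_ite, mul_zero]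

end stdSimplex

/-- The simplicial set whose `n`-simplices are all `(n + 1)`-tuples of elements of `A`. For a group
`A = G`, its realization is the universal cover `EG` of `BG`. -/
def SSet.tuples (A : Type u) : SSet.{u} where
  obj n := Fin (n.unop.len + 1) → A
  map θ := ↾fun x => x ∘ θ.unop

/-- The map of simplicial sets of tuples induced by a function. -/
def SSet.tuplesMap {A B : Type u} (F : A → B) : SSet.tuples A ⟶ SSet.tuples B where
  app n := ↾fun x => F ∘ x

/-- The space `EA` with vertex set `A`, which is contractible if `A` is nonempty. -/
abbrev ESpace (A : Type u) : TopCat.{u} := SSet.toTop.obj (SSet.tuples A)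

namespace ESpace

variable {A B C : Type u}

/-- The map `EA ⟶ EB` induced by a function. -/
abbrev map (F : A → B) : ESpace A ⟶ ESpace B := SSet.toTop.map (SSet.tuplesMap F)

/-- The point of `EA` with barycentric coordinates `t` in the simplex with vertices `x`. -/
abbrev pt {n : SimplexCategory} (x : Fin (n.len + 1) → A) (t : stdSimplex ℝ (Fin (n.len + 1))) :
    ESpace A :=
  SSet.point (X := SSet.tuples A) x t

theorem map_pt (F : A → B) {n : SimplexCategory} (x : Fin (n.len + 1) → A)
    (t : stdSimplex ℝ (Fin (n.len + 1))) : map F (pt x t) = pt (F ∘ x) t :=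
  SSet.toTop_map_point _ _ _

theorem exists_pt (e : ESpace A) :
    ∃ (n : SimplexCategory) (x : Fin (n.len + 1) → A) (t : _), pt x t = e :=
  SSet.exists_point e

theorem pt_comp {m n : SimplexCategory} (θ : m ⟶ n) (x : Fin (n.len + 1) → A)
    (t : stdSimplex ℝ (Fin (m.len + 1))) :
    pt (x ∘ θ) t = pt x (stdSimplex.map θ t) :=
  SSet.point_map θ (X := SSet.tuples A) x t

theorem map_id_apply (e : ESpace A) : map (fun a : A => a) e = e := by
  obtain ⟨n, x, t, rfl⟩ := exists_pt e
  exact map_pt _ _ _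

theorem map_map (F : A → B) (F' : B → C) (e : ESpace A) :
    map F' (map F e) = map (fun a => F' (F a)) e := by
  obtain ⟨n, x, t, rfl⟩ := exists_pt e
  rw [map_pt, map_pt, map_pt]
  rfl

/-- The join of two copies of a simplex. -/
abbrev doubled (n : SimplexCategory) : SimplexCategory := ⦋n.len + 1 + n.len⦌

/-- The functoriality of `doubled`. -/
def doubledMap {m n : SimplexCategory} (θ : m ⟶ n) : doubled m ⟶ doubled n :=
  SimplexCategory.mkHom ⟨Fin.joinMap θ, Fin.monotone_joinMap θ.toOrderHom.monotone⟩

/-- The simplex with vertices `x₀, …, xₙ, y₀, …, yₙ`. -/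
def appendTuple {n : SimplexCategory} (x y : Fin (n.len + 1) → A) :
    Fin ((doubled n).len + 1) → A :=
  (Fin.append x y : Fin ((n.len + 1) + (n.len + 1)) → A)

theorem comp_appendTuple (k : A → B) {n : SimplexCategory} (x y : Fin (n.len + 1) → A) :
    k ∘ appendTuple x y = appendTuple (k ∘ x) (k ∘ y) := by
  ext i
  refine Fin.addCases (m := n.len + 1) (n := n.len + 1) (fun j => ?_) (fun j => ?_) i
  · exact (congrArg k (Fin.append_left x y j)).trans (Fin.append_left (k ∘ x) (k ∘ y) j).symm
  · exact (congrArg k (Fin.append_right x y j)).trans (Fin.append_right (k ∘ x) (k ∘ y) j).symm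

theorem appendTuple_comp_doubledMap {m n : SimplexCategory} (θ : m ⟶ n)
    (x y : Fin (n.len + 1) → A) :
    appendTuple x y ∘ doubledMap θ = appendTuple (x ∘ θ) (y ∘ θ) := by
  ext i
  refine Fin.addCases (m := m.len + 1) (n := m.len + 1) (fun j => ?_) (fun j => ?_) i
  · refine (congrArg (Fin.append x y) (Fin.joinMap_castAdd θ j)).trans ?_
    exact (Fin.append_left x y _).trans (Fin.append_left (x ∘ θ) (y ∘ θ) j).symm
  · refine (congrArg (Fin.append x y) (Fin.joinMap_natAdd θ j)).trans ?_
    exact (Fin.append_right x y _).trans (Fin.append_right (x ∘ θ) (y ∘ θ) j).symm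

/-- The straight-line homotopy between the maps `EA → EB` induced by two functions `F` and `F'`,
which moves a point of the simplex `(x₀, …, xₙ)` inside the simplex
`(F x₀, …, F xₙ, F' x₀, …, F' xₙ)`. -/
def straightLine (F F' : A → B) : C(ESpace A, C(I, ESpace B)) :=
  SSet.toTopDesc
    (fun n (x : Fin (n.len + 1) → A) => ContinuousMap.curry
      ⟨fun p => pt (appendTuple (F ∘ x) (F' ∘ x)) (stdSimplex.join p.1 p.2),
        (SSet.continuous_point _).comp (stdSimplex.continuous_join _)⟩)
    (by
      intro m n θ (x : Fin (n.len + 1) → A) t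
      ext u
      change pt (appendTuple ((F ∘ x) ∘ θ) ((F' ∘ x) ∘ θ)) (stdSimplex.join t u) =
        pt (appendTuple (F ∘ x) (F' ∘ x)) (stdSimplex.join (stdSimplex.map θ t) u)
      rw [← stdSimplex.map_joinMap, ← appendTuple_comp_doubledMap]
      exact pt_comp (doubledMap θ) _ _)

theorem straightLine_pt (F F' : A → B) {n : SimplexCategory} (x : Fin (n.len + 1) → A)
    (t : stdSimplex ℝ (Fin (n.len + 1))) (u : I) :
    straightLine F F' (pt x t) u =
      pt (appendTuple (F ∘ x) (F' ∘ x)) (stdSimplex.join t u) := by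
  rw [straightLine]
  exact congrArg (fun γ : C(I, ESpace B) => γ u) (SSet.toTopDesc_point _ _ _ _)

theorem straightLine_zero (F F' : A → B) (e : ESpace A) : straightLine F F' e 0 = map F e := by
  obtain ⟨n, x, t, rfl⟩ := exists_pt e
  rw [straightLine_pt, map_pt, stdSimplex.join_zero]
  let θ : n ⟶ doubled n := SimplexCategory.mkHom
    ⟨Fin.castAdd (n.len + 1), (Fin.strictMono_castAdd _).monotone⟩
  refine (pt_comp θ _ t).symm.trans ?_
  refine congrArg (fun y => pt y t) (funext fun i => ?_)
  exact Fin.append_left (F ∘ x) (F' ∘ x) i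

theorem straightLine_one (F F' : A → B) (e : ESpace A) : straightLine F F' e 1 = map F' e := by
  obtain ⟨n, x, t, rfl⟩ := exists_pt e
  rw [straightLine_pt, map_pt, stdSimplex.join_one]
  let θ : n ⟶ doubled n := SimplexCategory.mkHom
    ⟨Fin.natAdd (n.len + 1), (Fin.strictMono_natAdd _).monotone⟩
  refine (pt_comp θ _ t).symm.trans ?_
  refine congrArg (fun y => pt y t) (funext fun i => ?_)
  exact Fin.append_right (F ∘ x) (F' ∘ x) i

theorem map_straightLine (F F' : A → B) (k : B → C) (e : ESpace A) (u : I) :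
    map k (straightLine F F' e u) = straightLine (fun a => k (F a)) (fun a => k (F' a)) e u := by
  obtain ⟨n, x, t, rfl⟩ := exists_pt e
  rw [straightLine_pt, straightLine_pt, map_pt, comp_appendTuple]
  rfl

theorem straightLine_map (k : C → A) (F F' : A → B) (e : ESpace C) :
    straightLine F F' (map k e) = straightLine (fun a => F (k a)) (fun a => F' (k a)) e := by
  obtain ⟨n, x, t, rfl⟩ := exists_pt e
  ext u
  rw [map_pt, straightLine_pt, straightLine_pt]
  rfl

theorem map_const_apply (b : B) (e : ESpace A) :
    map (fun _ => b) e = pt (n := ⦋0⦌) (fun _ => b) default := by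
  obtain ⟨n, x, t, rfl⟩ := exists_pt e
  let θ : n ⟶ ⦋0⦌ := SimplexCategory.const n ⦋0⦌ 0
  rw [map_pt]
  refine (pt_comp θ (fun _ => b) t).trans ?_
  congr 1
  exact Subsingleton.elim _ _

instance [Nonempty A] : PathConnectedSpace (ESpace A) := by
  obtain ⟨a⟩ := ‹Nonempty A›
  let e₀ : ESpace A := pt (n := ⦋0⦌) (fun _ => a) default
  have h (e : ESpace A) : Joined e e₀ :=
    ⟨⟨straightLine (fun a => a) (fun _ => a) e,
      (straightLine_zero _ _ e).trans (map_id_apply e),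
      (straightLine_one _ _ e).trans (map_const_apply a e)⟩⟩
  exact ⟨⟨e₀⟩, fun e e' => (h e).trans (h e').symm⟩

end ESpace

end

/-! ### Proper discontinuity of the action of `G` on `EG` -/

noncomputable section

open Opposite Simplicial unitInterval MeasureTheory

/-- Functions on `[0, 1)` with values in `A`, with the pseudometric which measures the set where two
functions differ. -/
@[ext]
structure StepFun (A : Type*) where
  /-- The underlying function. -/
  toFun : Set.Ico (0 : ℝ) 1 → A

namespace StepFun

variable {A B : Type*}

instance : PseudoEMetricSpace (StepFun A) where
  edist f g := volume (Subtype.val '' {x | f.toFun x ≠ g.toFun x})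
  edist_self f := by simp
  edist_comm f g := by simp only [ne_comm]
  edist_triangle f g h := by
    refine le_trans (measure_mono ?_) (measure_union_le _ _)
    rw [← Set.image_union]
    refine Set.image_mono fun x hx => ?_
    by_contra hc
    simp only [Set.mem_union, Set.mem_ofPred_eq, not_or, not_not] at hc
    exact hx (hc.1.trans hc.2)

theorem edist_def (f g : StepFun A) :
    edist f g = volume (Subtype.val '' {x | f.toFun x ≠ g.toFun x}) := rfl

theorem edist_eq_one {f g : StepFun A} (h : ∀ x, f.toFun x ≠ g.toFun x) : edist f g = 1 := by
  rw [edist_def]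
  have : {x | f.toFun x ≠ g.toFun x} = Set.univ := Set.eq_univ_of_forall h
  rw [this, Set.image_univ, Subtype.range_coe, Real.volume_Ico]
  simp

/-- Postcomposition of step functions with a function. -/
def map (F : A → B) (f : StepFun A) : StepFun B := ⟨fun x => F (f.toFun x)⟩

theorem edist_map_le (F : A → B) (f g : StepFun A) : edist (map F f) (map F g) ≤ edist f g :=
  measure_mono (Set.image_mono fun _ hx h => hx (congrArg F h))

theorem continuous_map (F : A → B) : Continuous (map F) :=
  (LipschitzWith.of_edist_le (edist_map_le F)).continuous

end StepFun

namespace stdSimplex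

variable {n : ℕ}

/-- The sum of the barycentric coordinates with index at most `i`. -/
def partialSum (t : stdSimplex ℝ (Fin n)) (i : Fin n) : ℝ := ∑ j with j ≤ i, t j

/-- `x` lies in the `i`-th interval of the partition of `[0, 1)` into intervals whose lengths are
the barycentric coordinates of `t`. -/
def IsStep (t : stdSimplex ℝ (Fin n)) (x : ℝ) (i : Fin n) : Prop :=
  ∑ j with j < i, t j ≤ x ∧ x < partialSum t i

theorem IsStep.le {t : stdSimplex ℝ (Fin n)} {x : ℝ} {i j : Fin n} (hi : IsStep t x i)
    (hj : IsStep t x j) : i ≤ j := by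
  by_contra h
  push Not at h
  refine absurd (hj.2.trans_le (le_trans ?_ hi.1)) (lt_irrefl x)
  refine Finset.sum_le_sum_of_subset_of_nonneg (fun k hk => ?_) fun k _ _ => stdSimplex.zero_le t k
  simp only [Finset.mem_filter, Finset.mem_univ, true_and] at hk ⊢
  exact hk.trans_lt h

theorem exists_isStep (t : stdSimplex ℝ (Fin (n + 1))) {x : ℝ} (hx : x ∈ Set.Ico (0 : ℝ) 1) :
    ∃ i, IsStep t x i := by
  classical
  have hex : ∃ i, x < partialSum t i := by
    refine ⟨Fin.last n, ?_⟩
    have : (Finset.univ.filter fun j => j ≤ Fin.last n) = Finset.univ :=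
      Finset.filter_true_of_mem fun j _ => Fin.le_last j
    rw [partialSum, this, stdSimplex.sum_eq_one]
    exact hx.2
  obtain ⟨i, hi, hmin⟩ := WellFounded.has_min (wellFounded_lt (α := Fin (n + 1)))
    {i | x < partialSum t i} hex
  refine ⟨i, ?_, hi⟩
  revert hi hmin
  refine Fin.cases (fun _ _ => ?_) (fun k _ hmin => ?_) i
  · simpa using hx.1
  · have := not_lt.1 fun h : x < partialSum t k.castSucc =>
      hmin k.castSucc h Fin.castSucc_lt_succ
    refine le_trans (le_of_eq ?_) this
    rw [partialSum]
    congr 1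
    ext j
    simp [Fin.lt_def, Fin.le_def]

/-- The index of the interval which contains `x`. -/
def stepIndex (t : stdSimplex ℝ (Fin (n + 1))) (x : Set.Ico (0 : ℝ) 1) : Fin (n + 1) :=
  (exists_isStep t x.2).choose

theorem isStep_stepIndex (t : stdSimplex ℝ (Fin (n + 1))) (x : Set.Ico (0 : ℝ) 1) :
    IsStep t x (stepIndex t x) :=
  (exists_isStep t x.2).choose_spec

theorem IsStep.map {m : ℕ} {t : stdSimplex ℝ (Fin m)} {x : ℝ} {i : Fin m} (hi : IsStep t x i)
    {θ : Fin m → Fin n} (hθ : Monotone θ) : IsStep (stdSimplex.map θ t) x (θ i) := by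
  have key (s : Fin n → Prop) [DecidablePred s] :
      ∑ j with s j, stdSimplex.map θ t j = ∑ j with s (θ j), t j := by
    simp only [map_apply]
    rw [Finset.sum_fiberwise_eq_sum_filter]
    simp
  constructor
  · rw [key]
    refine le_trans ?_ hi.1
    refine Finset.sum_le_sum_of_subset_of_nonneg (fun k hk => ?_)
      fun k _ _ => stdSimplex.zero_le t k
    simp only [Finset.mem_filter, Finset.mem_univ, true_and] at hk ⊢
    exact hθ.reflect_lt hk
  · rw [partialSum, key]
    refine lt_of_lt_of_le hi.2 ?_
    refine Finset.sum_le_sum_of_subset_of_nonneg (fun k hk => ?_)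
      fun k _ _ => stdSimplex.zero_le t k
    simp only [Finset.mem_filter, Finset.mem_univ, true_and] at hk ⊢
    exact hθ hk

theorem stepIndex_map {m n : ℕ} {θ : Fin (m + 1) → Fin (n + 1)} (hθ : Monotone θ)
    (t : stdSimplex ℝ (Fin (m + 1))) (x : Set.Ico (0 : ℝ) 1) :
    stepIndex (stdSimplex.map θ t) x = θ (stepIndex t x) :=
  have h := (isStep_stepIndex t x).map hθ
  le_antisymm ((isStep_stepIndex _ x).le h) (h.le (isStep_stepIndex _ x))

theorem mem_Ico_of_stepIndex_lt {t s : stdSimplex ℝ (Fin (n + 1))} {x : Set.Ico (0 : ℝ) 1}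
    (h : stepIndex t x < stepIndex s x) :
    (x : ℝ) ∈ Set.Ico (partialSum s (stepIndex t x)) (partialSum t (stepIndex t x)) := by
  refine ⟨le_trans ?_ (isStep_stepIndex s x).1, (isStep_stepIndex t x).2⟩
  refine Finset.sum_le_sum_of_subset_of_nonneg (fun k hk => ?_) fun k _ _ => stdSimplex.zero_le s k
  simp only [Finset.mem_filter, Finset.mem_univ, true_and] at hk ⊢
  exact hk.trans_lt h

/-- The step function with the intervals given by barycentric coordinates depends continuously on
these coordinates: it changes only between the old and the new end points of the intervals. -/
theorem continuous_stepIndex (n : ℕ) :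
    Continuous fun t : stdSimplex ℝ (Fin (n + 1)) => StepFun.mk (stepIndex t) := by
  rw [continuous_iff_continuousAt]
  intro t
  rw [ContinuousAt, tendsto_iff_edist_tendsto_0]
  have hc (i : Fin (n + 1)) :
      Continuous fun s : stdSimplex ℝ (Fin (n + 1)) => partialSum s i :=
    continuous_finsetSum _ fun j _ => (continuous_apply j).comp continuous_subtype_val
  have hlim : Filter.Tendsto (fun s : stdSimplex ℝ (Fin (n + 1)) =>
      ∑ i, ENNReal.ofReal |partialSum t i - partialSum s i|) (nhds t) (nhds 0) := by
    have h : Continuous fun s : stdSimplex ℝ (Fin (n + 1)) =>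
        ∑ i, ENNReal.ofReal |partialSum t i - partialSum s i| :=
      continuous_finsetSum _ fun i _ =>
        ENNReal.continuous_ofReal.comp (continuous_const.sub (hc i)).abs
    simpa using h.tendsto t
  refine tendsto_of_tendsto_of_tendsto_of_le_of_le tendsto_const_nhds hlim
    (fun _ => _root_.zero_le)
    fun s => ?_
  rw [StepFun.edist_def]
  calc _ ≤ volume (⋃ i, Set.uIcc (partialSum s i) (partialSum t i)) := by
        refine measure_mono ?_
        rintro _ ⟨x, hx, rfl⟩
        obtain h | h := lt_or_gt_of_ne hx
        · exact Set.mem_iUnion.2 ⟨stepIndex s x, Set.Icc_subset_uIcc'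
            (Set.Ico_subset_Icc_self (mem_Ico_of_stepIndex_lt h))⟩
        · exact Set.mem_iUnion.2 ⟨stepIndex t x, Set.Icc_subset_uIcc
            (Set.Ico_subset_Icc_self (mem_Ico_of_stepIndex_lt h))⟩
    _ ≤ ∑ i, volume (Set.uIcc (partialSum s i) (partialSum t i)) := measure_iUnion_fintype_le _ _
    _ = _ := by simp only [Real.volume_interval]

end stdSimplex

namespace ESpace

variable {A B : Type u}

/-- The map which sends the point with barycentric coordinates `t` in the simplex `(x₀, …, xₙ)` to
the step function with values `x₀, …, xₙ` on consecutive intervals of lengths `t₀, …, tₙ`. -/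
def toStepFun : C(ESpace A, StepFun A) :=
  SSet.toTopDesc
    (fun n (x : Fin (n.len + 1) → A) => ⟨fun t => StepFun.map x ⟨stdSimplex.stepIndex t⟩,
      (StepFun.continuous_map x).comp (stdSimplex.continuous_stepIndex n.len)⟩)
    (by
      intro m n θ (x : Fin (n.len + 1) → A) t
      ext r
      exact congrArg x (stdSimplex.stepIndex_map θ.toOrderHom.monotone t r).symm)

theorem toStepFun_pt {n : SimplexCategory} (x : Fin (n.len + 1) → A)
    (t : stdSimplex ℝ (Fin (n.len + 1))) :
    toStepFun (pt x t) = ⟨fun r => x (stdSimplex.stepIndex t r)⟩ :=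
  SSet.toTopDesc_point _ _ _ _

theorem toStepFun_map (F : A → B) (e : ESpace A) :
    toStepFun (map F e) = (toStepFun e).map F := by
  obtain ⟨n, x, t, rfl⟩ := exists_pt e
  rw [map_pt, toStepFun_pt, toStepFun_pt]
  rfl

variable {G H : Type u} [Group G] [Group H]

instance : MulAction G (ESpace G) where
  smul g e := map (fun x => g * x) e
  one_smul e := by
    change map (fun x => 1 * x) e = e
    simp only [one_mul]
    exact map_id_apply e
  mul_smul g h e := by
    change map (fun x => g * h * x) e = map (fun x => g * x) (map (fun x => h * x) e)
    simp only [map_map, mul_assoc]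

theorem smul_def (g : G) (e : ESpace G) : g • e = map (fun x => g * x) e := rfl

instance : ContinuousConstSMul G (ESpace G) :=
  ⟨fun g => (map fun x => g * x).hom.continuous⟩

theorem edist_toStepFun_smul {g : G} (hg : g ≠ 1) (e : ESpace G) :
    edist (toStepFun (g • e)) (toStepFun e) = 1 := by
  apply StepFun.edist_eq_one
  intro x
  rw [smul_def, toStepFun_map]
  simpa [StepFun.map] using hg

/-- The action of `G` on `EG` is properly discontinuous: a nontrivial element of `G` changes every
value of a step function, and therefore moves every step function by distance `1`. -/
theorem exists_nhds_smul_disjoint (e : ESpace G) :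
    ∃ U ∈ nhds e, ∀ g : G, ((g • ·) '' U ∩ U).Nonempty → g = 1 := by
  refine ⟨toStepFun ⁻¹' Metric.eball (toStepFun e) (1 / 2),
    toStepFun.continuous.continuousAt (Metric.eball_mem_nhds _ (by simp)), ?_⟩
  rintro g ⟨_, ⟨e', he', rfl⟩, hge'⟩
  by_contra hg
  have h := edist_triangle_right (toStepFun (g • e')) (toStepFun e') (toStepFun e)
  rw [edist_toStepFun_smul hg] at h
  have h' := ENNReal.add_lt_add hge' he'
  rw [ENNReal.add_halves] at h'
  exact absurd (h.trans_lt h') (lt_irrefl _)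

end ESpace

end

/-! ### The covering `EG → BG` -/

noncomputable section

open Opposite Simplicial unitInterval

namespace ESpace

variable {G H : Type u} [Group G] [Group H]

/-- The simplex of the nerve of `G` with edges `xⱼ⁻¹ xᵢ`, the invariants of the tuple `x` under left
translation. The order of the factors is dictated by `SingleObj`, in which `f ≫ g` is `g * f`. -/
def edges {n : ℕ} (x : Fin (n + 1) → G) : ComposableArrows (SingleObj G) n where
  obj _ := SingleObj.star G
  map {i j} _ := ((x j)⁻¹ * x i : G)
  map_id i := inv_mul_cancel (x i)
  map_comp {i j k} _ _ := by
    change (x k)⁻¹ * x i = ((x k)⁻¹ * x j) * ((x j)⁻¹ * x i)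
    group

/-- The element of `G` which labels an edge of a simplex of the nerve of `G`. -/
def edge {n : ℕ} (F : ComposableArrows (SingleObj G) n) (i j : Fin (n + 1)) (h : i ≤ j) : G :=
  F.map (homOfLE h)

theorem edge_mul {n : ℕ} (F : ComposableArrows (SingleObj G) n) {i j k : Fin (n + 1)} (h : i ≤ j)
    (h' : j ≤ k) : edge F j k h' * edge F i j h = edge F i k (h.trans h') :=
  (F.map_comp (homOfLE h) (homOfLE h')).symm

theorem ext_edge {n : ℕ} {F F' : ComposableArrows (SingleObj G) n}
    (h : ∀ i j hij, edge F i j hij = edge F' i j hij) : F = F' := by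
  obtain ⟨o, m, _, _⟩ := F
  obtain ⟨o', m', _, _⟩ := F'
  obtain rfl : o = o' := funext fun _ => Quiver.SingleObj.ext
  have : @m = @m' := by
    funext i j f
    exact h i j (leOfHom f)
  subst this
  rfl

/-- The vertices of the lift of a simplex of the nerve of `G` whose first vertex is `1`. -/
def vertices {n : ℕ} (F : ComposableArrows (SingleObj G) n) (i : Fin (n + 1)) : G :=
  (edge F 0 i (Fin.zero_le i))⁻¹

theorem edges_vertices {n : ℕ} (F : ComposableArrows (SingleObj G) n) : edges (vertices F) = F := by
  apply ext_edge
  intro i j h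
  change (vertices F j)⁻¹ * vertices F i = _
  rw [vertices, vertices, inv_inv, ← edge_mul F (Fin.zero_le i) h, mul_inv_cancel_right]

theorem vertices_edges {n : ℕ} (x : Fin (n + 1) → G) (i : Fin (n + 1)) :
    vertices (edges x) i = (x 0)⁻¹ * x i := by
  change ((x i)⁻¹ * x 0)⁻¹ = _
  group

/-- The projection of simplicial sets underlying the universal cover `EG → BG`. -/
def tuplesToNerve (G : Type u) [Group G] : SSet.tuples G ⟶ nerve (SingleObj G) where
  app n := ↾fun x : Fin (n.unop.len + 1) → G => edges x

/-- The universal cover `EG → BG`, sending the simplex with vertices `xᵢ` to the one with edges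
`xⱼ⁻¹ xᵢ`. -/
def proj (G : Type u) [Group G] : ESpace G ⟶ classifyingSpace G := SSet.toTop.map (tuplesToNerve G)

/-- The point of `BG` with barycentric coordinates `t` in a simplex of the nerve. -/
abbrev basePt {n : SimplexCategory} (F : ComposableArrows (SingleObj G) n.len)
    (t : stdSimplex ℝ (Fin (n.len + 1))) : classifyingSpace G :=
  SSet.point (X := nerve (SingleObj G)) F t

theorem proj_pt {n : SimplexCategory} (x : Fin (n.len + 1) → G)
    (t : stdSimplex ℝ (Fin (n.len + 1))) : proj G (pt x t) = basePt (edges x) t :=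
  SSet.toTop_map_point _ _ _

theorem proj_surjective : Function.Surjective (proj G) := by
  intro b
  obtain ⟨n, F, t, rfl⟩ := SSet.exists_point (X := nerve (SingleObj G)) b
  exact ⟨pt (vertices F) t, (proj_pt _ _).trans (congrArg (fun F => basePt F t) (edges_vertices F))⟩

theorem proj_smul (g : G) (e : ESpace G) : proj G (g • e) = proj G e := by
  obtain ⟨n, x, t, rfl⟩ := exists_pt e
  rw [smul_def, map_pt, proj_pt, proj_pt]
  congr 1
  apply ext_edge
  intro i j h
  change (g * x j)⁻¹ * (g * x i) = (x j)⁻¹ * x i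
  group

theorem smul_pt (g : G) {n : SimplexCategory} (x : Fin (n.len + 1) → G)
    (t : stdSimplex ℝ (Fin (n.len + 1))) : g • pt x t = pt (fun i => g * x i) t :=
  map_pt _ _ _

/-- The orbit space of the action of `G` on `EG`. -/
abbrev OrbitSpace (G : Type u) [Group G] : Type u := MulAction.orbitRel.Quotient G (ESpace G)

/-- The map from `BG` to the orbit space of `EG`, which lifts every simplex to `EG`. -/
def toOrbitSpace (G : Type u) [Group G] : C(classifyingSpace G, OrbitSpace G) :=
  SSet.toTopDesc (X := nerve (SingleObj G))
    (fun n (F : ComposableArrows (SingleObj G) n.len) =>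
      ⟨fun t => Quotient.mk _ (pt (vertices F) t),
        continuous_quotient_mk'.comp (SSet.continuous_point _)⟩)
    (by
      intro m n θ (F : ComposableArrows (SingleObj G) n.len) t
      refine Quotient.sound ⟨edge F 0 (θ 0) (Fin.zero_le _), ?_⟩
      change _ • pt (vertices F) (stdSimplex.map θ t) = _
      rw [← pt_comp, smul_pt]
      congr 1
      funext i
      have hθ : θ 0 ≤ θ i := θ.toOrderHom.monotone (Fin.zero_le i)
      change edge F 0 (θ 0) (Fin.zero_le _) * (edge F 0 (θ i) (Fin.zero_le _))⁻¹ =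
        (edge F (θ 0) (θ i) hθ)⁻¹
      rw [← edge_mul F (Fin.zero_le (θ 0)) hθ, mul_inv_rev, mul_inv_cancel_left])

theorem toOrbitSpace_proj (e : ESpace G) : toOrbitSpace G (proj G e) = Quotient.mk _ e := by
  obtain ⟨n, x, t, rfl⟩ := exists_pt e
  rw [proj_pt]
  refine (SSet.toTopDesc_point _ _ _ _).trans (Quotient.sound ⟨(x 0)⁻¹, ?_⟩)
  change _ • pt x t = pt (vertices (edges x)) t
  rw [smul_pt]
  congr 1
  funext i
  exact (vertices_edges x i).symm

/-- The orbit space of the action of `G` on `EG` is `BG`. -/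
def orbitSpaceHomeomorph (G : Type u) [Group G] : OrbitSpace G ≃ₜ classifyingSpace G where
  toFun := Quotient.lift (proj G) (by
    rintro _ e ⟨g, rfl⟩
    exact proj_smul g e)
  invFun := toOrbitSpace G
  left_inv := by
    rintro ⟨e⟩
    exact toOrbitSpace_proj e
  right_inv b := by
    obtain ⟨e, rfl⟩ := proj_surjective b
    rw [toOrbitSpace_proj]
    rfl
  continuous_toFun := (proj G).hom.continuous.quotient_lift _
  continuous_invFun := (toOrbitSpace G).continuous

/-- The projection `EG → BG` is a covering map, the quotient map for the free and properly
discontinuous action of `G`. -/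
theorem isQuotientCoveringMap_proj (G : Type u) [Group G] :
    IsQuotientCoveringMap (proj G) G where
  toIsQuotientMap := (orbitSpaceHomeomorph G).isQuotientMap.comp isQuotientMap_quotient_mk'
  apply_eq_iff_mem_orbit {e₁ e₂} := by
    constructor
    · intro h
      have h' := congrArg (toOrbitSpace G) h
      rw [toOrbitSpace_proj, toOrbitSpace_proj] at h'
      exact Quotient.exact h'
    · rintro ⟨g, rfl⟩
      exact proj_smul g e₂
  disjoint := exists_nhds_smul_disjoint

theorem classifyingSpaceMap_proj (φ : G →* H) (e : ESpace G) :
    classifyingSpaceMap φ (proj G e) = proj H (map φ e) := by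
  obtain ⟨n, x, t, rfl⟩ := exists_pt e
  rw [proj_pt, map_pt, proj_pt]
  refine (SSet.toTop_map_point _ _ _).trans ?_
  congr 1
  apply ext_edge
  intro i j h
  exact (map_mul φ _ _).trans (congrArg (· * φ (x i)) (map_inv φ _))

theorem map_smul_eq (φ : G →* H) (g : G) (e : ESpace G) : map φ (g • e) = φ g • map φ e := by
  rw [smul_def, smul_def, map_map, map_map]
  simp only [map_mul]

end ESpace

theorem connectedSpace_classifyingSpace (G : Type u) [Group G] :
    ConnectedSpace (classifyingSpace G) :=
  ESpace.proj_surjective.connectedSpace (ESpace.proj G).hom.continuous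

end

/-! ### Maps defined by monodromy -/

noncomputable section

open unitInterval Topology

namespace IsQuotientCoveringMap

variable {E X S Z G : Type*} [TopologicalSpace E] [TopologicalSpace X] [TopologicalSpace S]
  [TopologicalSpace Z] [Group G] [MulAction G E] {p : E → X}

theorem _root_.Path.Homotopic.Quotient.map_trans {X Y : Type*} [TopologicalSpace X]
    [TopologicalSpace Y] {x y z : X} (γ : Path.Homotopic.Quotient x y)
    (δ : Path.Homotopic.Quotient y z) (f : C(X, Y)) :
    (γ.trans δ).map f = (γ.map f).trans (δ.map f) := by
  obtain ⟨γ⟩ := γ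
  obtain ⟨δ⟩ := δ
  exact congrArg Path.Homotopic.Quotient.mk (Path.map_trans γ δ f.continuous)

open Path.Homotopic.Quotient in
/-- Let `p : E → X` be the quotient by a covering group action, and let `f : S → X`. Suppose that
for every `s : S` a map `Ψ s` on `E` is given which is invariant under the monodromy, at the lift
`ε s` of `f s`, of the loops at `s`. Then `S` carries a continuous map which is locally `Ψ s'`
applied to a lift of `f`: in every path component, choose a base point `s'`, and evaluate `Ψ s'`
at the endpoint of the lift of `f ∘ γ` from `ε s'`, where `γ` is any path from `s'`. -/
theorem exists_continuousMap_of_monodromy_invariant (hp : IsQuotientCoveringMap p G)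
    [LocallyPathConnectedSpace S] (f : C(S, X)) (ε : S → E) (hε : ∀ s, p (ε s) = f s)
    (Ψ : S → C(E, Z))
    (hΨ : ∀ (s : S) (γ : Path.Homotopic.Quotient s s) (g : G),
      (hp.isCoveringMap.monodromy (γ.map f) ⟨ε s, hε s⟩ : E) = g • ε s →
        ∀ e, Ψ s (g • e) = Ψ s e) :
    ∃ F : C(S, Z), ∀ s, ∃ s' e, p e = f s ∧ F s = Ψ s' e := by
  have cov := hp.isCoveringMap
  -- the value at the endpoint of a lifted path depends only on the endpoint of the path
  have indep (s s' : S) (γ γ' : Path.Homotopic.Quotient s s') :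
      Ψ s (cov.monodromy (γ.map f) ⟨ε s, hε s⟩) = Ψ s (cov.monodromy (γ'.map f) ⟨ε s, hε s⟩) := by
    obtain ⟨g, hg⟩ := hp.exists_toPermFiber_eq ⟨ε s, hε s⟩
      (cov.monodromy ((γ.trans γ'.symm).map f) ⟨ε s, hε s⟩)
    have h1 : cov.monodromy (γ.map f) ⟨ε s, hε s⟩ =
        hp.toPermFiber _ g (cov.monodromy (γ'.map f) ⟨ε s, hε s⟩) := by
      have h2 : γ = (γ.trans γ'.symm).trans γ' := by simp
      conv_lhs => rw [h2, map_trans, cov.monodromy_trans_apply, ← hg]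
      exact hp.monodromy_toPermFiber
    rw [h1]
    exact hΨ s _ g (congrArg Subtype.val hg.symm) _
  -- the base point of the path component of `s`
  let b : S → S := fun s => (Quotient.mk (pathSetoid S) s).out
  have hb (s : S) : Joined (b s) s := Quotient.mk_out (s := pathSetoid S) s
  have hbb {s s' : S} (h : Joined s s') : b s = b s' :=
    congrArg Quotient.out (Quotient.sound (s := pathSetoid S) h)
  let F : S → Z := fun s =>
    Ψ (b s) (cov.monodromy ((Path.Homotopic.Quotient.mk (hb s).somePath).map f) ⟨ε (b s), hε (b s)⟩)
  have hF (s b₀ : S) (h : b₀ = b s) (γ : Path.Homotopic.Quotient b₀ s) :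
      F s = Ψ b₀ (cov.monodromy (γ.map f) ⟨ε b₀, hε b₀⟩) := by
    subst h
    exact indep _ _ _ _
  refine ⟨⟨F, continuous_iff_continuousAt.2 fun s => ?_⟩, fun s => ⟨_, _, ?_, rfl⟩⟩
  · let γ := Path.Homotopic.Quotient.mk (hb s).somePath
    let e := cov.monodromy (γ.map f) ⟨ε (b s), hε (b s)⟩
    obtain ⟨φ, heφ, hφ⟩ := cov.isLocalHomeomorph e.1
    have hes : p e.1 = f s := e.2
    have hfs : f s ∈ φ.target := by
      simpa only [← hφ, hes] using φ.map_source heφ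
    -- near `s`, the lift is given by the local inverse `φ.symm` of `p`
    have ⟨U, ⟨hsU, hU⟩, hUφ⟩ := (path_connected_basis s).mem_iff.mp
      ((φ.open_target.preimage f.continuous).mem_nhds hfs)
    refine ContinuousAt.congr (f := fun x => Ψ (b s) (φ.symm (f x)))
      ((Ψ (b s)).continuous.continuousAt.comp
        ((φ.continuousAt_symm hfs).comp f.continuous.continuousAt)) ?_
    refine Filter.mem_of_superset hsU fun x hx => ?_
    obtain ⟨δ, hδ⟩ := hU.joinedIn _ (mem_of_mem_nhds hsU) _ hx
    have hfx : p (φ.symm (f x)) = f x := by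
      rw [hφ]
      exact φ.right_inv (hUφ hx)
    have key : cov.monodromy ((Path.Homotopic.Quotient.mk δ).map f) e = ⟨φ.symm (f x), hfx⟩ := by
      let Γ : C(I, E) := ⟨fun t => φ.symm (f (δ t)), φ.continuousOn_symm.comp_continuous
        (f.continuous.comp δ.continuous) fun t => hUφ (hδ t)⟩
      have h1 : Γ = cov.liftPath (δ.map f.continuous) e.1 (by simp [hes]) := by
        rw [cov.eq_liftPath_iff']
        refine ⟨funext fun t => ?_, ?_⟩
        · simp only [Γ, Function.comp_apply, ContinuousMap.coe_mk, hφ]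
          exact φ.right_inv (hUφ (hδ t))
        · simp only [Γ, ContinuousMap.coe_mk, Path.source]
          simpa only [← hφ, hes] using φ.left_inv heφ
      refine Subtype.ext ?_
      change cov.liftPath (δ.map f.continuous) e.1 _ 1 = _
      rw [← h1]
      simp [Γ]
    change Ψ (b s) (φ.symm (f x)) = F x
    rw [hF x (b s) (hbb ⟨δ⟩) (γ.trans (.mk δ)), map_trans, cov.monodromy_trans_apply, key]
  · exact (cov.monodromy ((Path.Homotopic.Quotient.mk (hb s).somePath).map f) ⟨ε (b s), hε (b s)⟩).2

end IsQuotientCoveringMap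

end

/-! ### Local path connectedness of CW-complexes -/

noncomputable section

open Limits Topology HomotopicalAlgebra

/-- A colimit of spaces is locally path connected as soon as enough of the spaces in the diagram
are: every index has to map to one whose space is locally path connected. In this form the result
applies to a pushout in which nothing is known about the source of the span. -/
theorem CategoryTheory.Limits.IsColimit.locallyPathConnectedSpace {J : Type*} [Category J]
    {F : J ⥤ TopCat.{u}} {c : Cocone F} (hc : IsColimit c)
    (h : ∀ j, ∃ j', Nonempty (j ⟶ j') ∧ LocallyPathConnectedSpace (F.obj j')) :
    LocallyPathConnectedSpace c.pt := by
  refine locallyPathConnectedSpace_iff_isOpen_pathComponentIn.mpr fun y U hU => ?_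
  rw [TopCat.isOpen_iff_of_isColimit c hc]
  intro j
  obtain ⟨j', ⟨φ⟩, hj'⟩ := h j
  suffices IsOpen (c.ι.app j' ⁻¹' pathComponentIn U y) by
    rw [← c.w φ, TopCat.coe_comp, Set.preimage_comp]
    exact this.preimage (F.map φ).hom.continuous
  have hf := (c.ι.app j').hom.continuous
  refine isOpen_iff_mem_nhds.mpr fun x hx => ?_
  have hx' : x ∈ c.ι.app j' ⁻¹' U := Set.preimage_mono pathComponentIn_subset hx
  refine mem_nhds_iff.mpr ⟨pathComponentIn (c.ι.app j' ⁻¹' U) x, ?_,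
    (hU.preimage hf).pathComponentIn _, mem_pathComponentIn_self hx'⟩
  rw [← Set.image_subset_iff, ← pathComponentIn_congr hx]
  exact ((isPathConnected_pathComponentIn hx').image hf).subset_pathComponentIn
    ⟨x, mem_pathComponentIn_self hx', rfl⟩
    ((Set.image_mono pathComponentIn_subset).trans (Set.image_preimage_subset _ U))

theorem TopCat.locallyPathConnectedSpace_disk (n : ℕ) :
    LocallyPathConnectedSpace (TopCat.disk.{u} n) := by
  have := (convex_closedBall (0 : EuclideanSpace ℝ (Fin n)) 1).locallyPathConnectedSpace
  exact Homeomorph.ulift.isOpenEmbedding.locallyPathConnectedSpace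

theorem TopCat.CWComplex.locallyPathConnectedSpace {X : TopCat.{u}} (c : TopCat.CWComplex X) :
    LocallyPathConnectedSpace X := by
  have hsk (n : ℕ) : LocallyPathConnectedSpace (c.F.obj n) := by
    induction n with
    | zero =>
      have : IsEmpty (c.F.obj 0) :=
        ⟨fun x => PEmpty.elim ((initialIsInitial.uniqueUpToIso TopCat.isInitialPEmpty).hom
          (c.isoBot.hom x))⟩
      exact ⟨fun x => isEmptyElim x⟩
    | succ n ih =>
      have a := c.attachCells n (not_isMax n)
      have hdisks : LocallyPathConnectedSpace a.cofan₂.pt :=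
        a.isColimit₂.locallyPathConnectedSpace fun j =>
          ⟨j, ⟨𝟙 j⟩, TopCat.locallyPathConnectedSpace_disk n⟩
      refine a.isPushout.isColimit.locallyPathConnectedSpace fun j => ?_
      obtain (_ | _ | _) := j
      · exact ⟨.left, ⟨WalkingSpan.Hom.fst⟩, ih⟩
      · exact ⟨.left, ⟨𝟙 _⟩, ih⟩
      · exact ⟨.right, ⟨𝟙 _⟩, hdisks⟩
  exact c.isColimit.locallyPathConnectedSpace fun n => ⟨n, ⟨𝟙 n⟩, hsk n⟩

end

/-! ### The shift on small sets of essentially constant permutations -/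

noncomputable section

open Cardinal

section Permutations

variable {α : Cardinal.{u}}

theorem Cardinal.IsRegular.nonempty_toType (hα : α.IsRegular) : Nonempty α.ord.ToType :=
  mk_ne_zero_iff.mp <| by
    rw [mk_ord_toType]
    exact hα.pos.ne'

/-- A subset of a regular cardinal of smaller cardinality is strictly bounded. -/
theorem Cardinal.IsRegular.exists_forall_lt (hα : α.IsRegular) (s : Set α.ord.ToType)
    (hs : #s < α) : ∃ β, ∀ γ ∈ s, γ < β := by
  have h : ¬ IsCofinal s := fun h => by
    have := Order.cof_le h
    rw [Ordinal.cof_toType, hα.cof_ord] at this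
    exact this.not_gt hs
  simpa [IsCofinal] using h

theorem Cardinal.IsRegular.le_mk_Ioi (hα : α.IsRegular) (β : α.ord.ToType) :
    α ≤ #(Set.Ioi β) := by
  have := noMaxOrder hα.aleph0_le
  by_contra! h
  obtain ⟨δ, hδ⟩ := hα.exists_forall_lt _ h
  obtain ⟨γ, hγ⟩ := exists_gt β
  exact lt_irrefl δ (hδ δ (hγ.trans (hδ γ hγ)))

/-- Fewer than `α` essentially constant permutations of a regular cardinal `α` all live on a
common `β < α`. -/
theorem Cardinal.IsRegular.exists_forall_essConstPerm_fixes (hα : α.IsRegular)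
    (H : Set (essConstPerm α.ord)) (hH : #H < α) :
    ∃ β, ∀ σ ∈ H, ∀ γ, β ≤ γ → σ.1 γ = γ := by
  have := hα.nonempty_toType
  choose b hb using fun σ : essConstPerm α.ord => (mem_essConstPerm σ.1).mp σ.2
  obtain ⟨β, hβ⟩ := hα.exists_forall_lt (b '' H) (mk_image_le.trans_lt hH)
  exact ⟨β, fun σ hσ γ hγ => hb σ γ ((hβ _ ⟨σ, hσ, rfl⟩).le.trans hγ)⟩

theorem Cardinal.IsRegular.viaEmbedding_mem_essConstPerm (hα : α.IsRegular) {A : Type u}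
    (hA : #A < α) (σ : Equiv.Perm A) (ι : A ↪ α.ord.ToType) :
    σ.viaEmbedding ι ∈ essConstPerm α.ord := by
  have := hα.nonempty_toType
  obtain ⟨β, hβ⟩ := hα.exists_forall_lt (Set.range ι) (mk_range_le.trans_lt hA)
  refine (mem_essConstPerm _).mpr ⟨β, fun γ hγ => ?_⟩
  exact σ.viaEmbedding_apply_of_notMem ι γ fun h => (hβ γ h).not_ge hγ

/-- On `β < α`, the successor map agrees with an essentially constant permutation: exchange `β`
with a disjoint copy of itself above `β`, and then that copy with the set of the `γ + 1`. -/
theorem Cardinal.IsRegular.exists_essConstPerm_eq_succ (hα : α.IsRegular) (β : α.ord.ToType) :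
    ∃ d : essConstPerm α.ord, ∀ γ < β, d.1 γ = Order.succ γ := by
  have := noMaxOrder hα.aleph0_le
  have hB : #(Set.Iio β) < α := by simpa using mk_Iio_lt β (by simp)
  obtain ⟨ι⟩ : Nonempty (Set.Iio β ↪ Set.Ioi β) := hB.le.trans (hα.le_mk_Ioi β)
  have hBB : #(Set.Iio β ⊕ Set.Iio β) < α := by
    rw [mk_sum, lift_id]
    exact add_lt_of_lt hα.aleph0_le hB hB
  -- `e₁` parametrizes `β` and its copy, `e₂` the copy and the successors of elements of `β`
  let e₁ : Set.Iio β ⊕ Set.Iio β ↪ α.ord.ToType :=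
    ⟨Sum.elim Subtype.val fun γ => (ι γ).1, Function.Injective.sumElim Subtype.val_injective
      (Subtype.val_injective.comp ι.injective) fun γ δ => (γ.2.trans (ι δ).2).ne⟩
  let e₂ : Set.Iio β ⊕ Set.Iio β ↪ α.ord.ToType :=
    ⟨Sum.elim (fun γ => (ι γ).1) fun γ => Order.succ γ.1, Function.Injective.sumElim
      (Subtype.val_injective.comp ι.injective)
      (Order.succ_injective.comp Subtype.val_injective)
      fun γ δ => ((Order.succ_le_of_lt δ.2).trans_lt (ι γ).2).ne'⟩
  refine ⟨⟨_, hα.viaEmbedding_mem_essConstPerm hBB (Equiv.sumComm _ _) e₂⟩ *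
    ⟨_, hα.viaEmbedding_mem_essConstPerm hBB (Equiv.sumComm _ _) e₁⟩, fun γ hγ => ?_⟩
  have h₁ := Equiv.Perm.viaEmbedding_apply (Equiv.sumComm _ _) e₁ (.inl ⟨γ, hγ⟩)
  have h₂ := Equiv.Perm.viaEmbedding_apply (Equiv.sumComm _ _) e₂ (.inl ⟨γ, hγ⟩)
  exact (congrArg _ h₁).trans h₂

/-- The shift is given by conjugation with a single permutation on every set of fewer than
`α` essentially constant permutations. -/
theorem exists_shift_mul_eq (hα : α.IsRegular) (H : Set (essConstPerm α.ord)) (hH : #H < α) :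
    ∃ d : essConstPerm α.ord, ∀ σ ∈ H, shift α hα.aleph0_le σ * d = d * σ := by
  have := noMaxOrder hα.aleph0_le
  obtain ⟨β, hβ⟩ := hα.exists_forall_essConstPerm_fixes H hH
  obtain ⟨d, hd⟩ := hα.exists_essConstPerm_eq_succ β
  refine ⟨d, fun σ hσ => Subtype.ext (Equiv.ext fun γ => ?_)⟩
  change (shift α hα.aleph0_le σ).1 (d.1 γ) = d.1 (σ.1 γ)
  obtain hγ | hγ := lt_or_ge γ β
  · have hσγ : σ.1 γ < β := by
      by_contra! h
      exact hγ.not_ge (σ.1.injective (hβ σ hσ _ h) ▸ h)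
    rw [hd _ hγ, hd _ hσγ, shift_apply_succ]
  -- here `σ γ = γ`; as `d γ` is not the successor of an element of `β`, the shift of `σ` fixes it
  · rw [hβ σ hσ γ hγ]
    by_cases h : ∃ γ', d.1 γ = Order.succ γ'
    · obtain ⟨γ', h⟩ := h
      have hγ' : β ≤ γ' := by
        by_contra! h'
        exact h'.not_ge (d.1.injective (h.trans (hd _ h').symm) ▸ hγ)
      rw [h, shift_apply_succ, hβ σ hσ γ' hγ']
    · exact shift_apply_of_not_succ α _ σ _ (by simpa using h)

/-- Every shifted permutation fixes the zero ordinal, unlike the transposition of `0` and `1`. -/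
theorem not_surjective_shift (hα : α.IsRegular) :
    ¬ Function.Surjective (shift α hα.aleph0_le) := by
  have := noMaxOrder hα.aleph0_le
  have := hα.nonempty_toType
  obtain ⟨z, -, hz⟩ := WellFounded.has_min (wellFounded_lt (α := α.ord.ToType)) Set.univ
    Set.univ_nonempty
  have hz (γ) : z ≤ γ := not_lt.mp (hz γ trivial)
  have hz₁ : z < Order.succ z := Order.lt_succ z
  intro h
  obtain ⟨σ, hσ⟩ := h ⟨Equiv.swap z (Order.succ z), (mem_essConstPerm _).mpr
    ⟨Order.succ (Order.succ z), fun γ hγ => by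
      have h₁ := (Order.lt_succ (Order.succ z)).trans_le hγ
      exact Equiv.swap_apply_of_ne_of_ne (hz₁.trans h₁).ne' h₁.ne'⟩⟩
  have h₁ := shift_apply_of_not_succ α hα.aleph0_le σ z
    fun γ' h' => ((Order.lt_succ γ').trans_le (h' ▸ hz γ')).false
  rw [hσ] at h₁
  exact hz₁.ne' ((Equiv.swap_apply_left z (Order.succ z)).symm.trans h₁)

/-- The successor of an infinite cardinal which bounds all the fundamental groups is regular. -/
theorem exists_isLargeFor (G : Set Hot.{u}) [Small.{u} G] :
    ∃ α : Cardinal.{u}, IsLargeFor α G := by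
  let T := Σ S : Shrink.{u} G, ((equivShrink G).symm S).1.space
  let f : T → Cardinal.{u} := fun t => #(FundamentalGroup _ t.2)
  refine ⟨Order.succ (ℵ₀ + Cardinal.sum f), isRegular_succ le_self_add, fun S hS s => ?_⟩
  obtain ⟨i, hi⟩ := (equivShrink G).symm.surjective ⟨S, hS⟩
  obtain rfl : ((equivShrink G).symm i).1 = S := congrArg Subtype.val hi
  exact Order.lt_succ_of_le ((le_sum f ⟨i, s⟩).trans le_add_self)

end Permutations

end

/-! ### Homotopies between maps of classifying spaces -/

noncomputable section

open Cardinal unitInterval Topology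

section ClassifyingSpace

variable {G H : Type u} [Group G] [Group H]

open ESpace

/-- Let `φ` and `ψ` be homomorphisms which are conjugate on every small subset of `G`. If the
fundamental groups of `S` are small, then `Bφ` and `Bψ` agree up to homotopy on maps from `S`.

If `φ g * d = d * ψ g` for the elements `g` by which the loops at `s` act, then the straight line
homotopy on `EG` from `d ψ` to `φ` is equivariant for these elements, and after projection to `BH`
it descends along the map `h`. -/
theorem homotopic_classifyingSpaceMap_comp {κ : Cardinal.{u}} (φ ψ : G →* H)
    (hφψ : ∀ K : Set G, #K < κ → ∃ d, ∀ g ∈ K, φ g * d = d * ψ g)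
    {S : Type u} [TopologicalSpace S] [LocallyPathConnectedSpace S]
    (hS : ∀ s : S, #(FundamentalGroup S s) < κ) (h : C(S, classifyingSpace G)) :
    ((classifyingSpaceMap ψ).hom.comp h).Homotopic ((classifyingSpaceMap φ).hom.comp h) := by
  have hp := isQuotientCoveringMap_proj G
  choose ε hε using fun s => proj_surjective (h s)
  have hd (s : S) : ∃ d, ∀ (γ : Path.Homotopic.Quotient s s) (g : G),
      (hp.isCoveringMap.monodromy (γ.map h) ⟨ε s, hε s⟩ : ESpace G) = g • ε s →
        φ g * d = d * ψ g := by
    choose k hk using fun γ : Path.Homotopic.Quotient s s => hp.exists_toPermFiber_eq ⟨ε s, hε s⟩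
      (hp.isCoveringMap.monodromy (γ.map h) ⟨ε s, hε s⟩)
    obtain ⟨d, hd⟩ := hφψ (Set.range k) (mk_range_le.trans_lt (hS s))
    refine ⟨d, fun γ g hg => ?_⟩
    obtain rfl : k γ = g := hp.toPermFiber_ext _ ⟨ε s, hε s⟩ ((hk γ).trans (Subtype.ext hg))
    exact hd _ ⟨γ, rfl⟩
  choose d hd using hd
  let Ψ (s : S) : C(ESpace G, C(I, classifyingSpace H)) :=
    ⟨fun e => (proj H).hom.comp (straightLine (fun a => d s * ψ a) (fun a => φ a) e),
      (ContinuousMap.continuous_postcomp _).comp (ContinuousMap.continuous _)⟩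
  obtain ⟨F, hF⟩ := hp.exists_continuousMap_of_monodromy_invariant h ε hε Ψ (by
    intro s γ g hg e
    ext u
    change proj H (straightLine _ _ (map (g * ·) e) u) = proj H (straightLine _ _ e u)
    refine Eq.trans ?_ (proj_smul (φ g) _)
    rw [straightLine_map, smul_def, map_straightLine]
    simp only [map_mul, ← mul_assoc, hd s γ g hg])
  have hF' : Continuous fun p : I × S => F p.2 p.1 := by fun_prop
  refine ⟨⟨⟨_, hF'⟩, fun s => ?_, fun s => ?_⟩⟩
  · obtain ⟨s', e, he, hs⟩ := hF s
    change F s 0 = classifyingSpaceMap ψ (h s)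
    rw [hs, ← he, classifyingSpaceMap_proj]
    change proj H (straightLine _ _ e 0) = _
    rw [straightLine_zero, ← proj_smul (d s') (map ψ e), smul_def, map_map]
  · obtain ⟨s', e, he, hs⟩ := hF s
    change F s 1 = classifyingSpaceMap φ (h s)
    rw [hs, ← he, classifyingSpaceMap_proj]
    change proj H (straightLine _ _ e 1) = _
    rw [straightLine_one]

/-- If `Bφ` has a right homotopy inverse `r`, then `φ` is surjective. The homotopy lifts to an
equivariant deformation of `EH`. Lifting a path from `e₀` to `k • e₀` along `Bφ ∘ r` in two ways,
through this deformation and through `EG`, shows that `k` is conjugate to a value of `φ`, by an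
element `c` which does not depend on `k`. -/
theorem surjective_of_homotopic_id (φ : G →* H) (r : C(classifyingSpace H, classifyingSpace G))
    (hr : (ContinuousMap.id _).Homotopic ((classifyingSpaceMap φ).hom.comp r)) :
    Function.Surjective φ := by
  obtain ⟨K⟩ := hr
  have hpG := isQuotientCoveringMap_proj G
  have hpH := isQuotientCoveringMap_proj H
  have covG := hpG.isCoveringMap
  have covH := hpH.isCoveringMap
  -- lift the homotopy to an equivariant deformation of `EH`
  let L : C(I × ESpace H, ESpace H) := covH.liftHomotopy
    (K.toContinuousMap.comp ((ContinuousMap.id I).prodMap (proj H).hom)) (ContinuousMap.id _)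
    (fun e => K.map_zero_left _)
  have hL (t : I) (e : ESpace H) : proj H (L (t, e)) = K (t, proj H e) :=
    congrFun (covH.liftHomotopy_lifts _ _ _) (t, e)
  have hL₀ (e : ESpace H) : L (0, e) = e := covH.liftHomotopy_zero _ _ _ e
  have hL₁ (e : ESpace H) : proj H (L (1, e)) = classifyingSpaceMap φ (r (proj H e)) :=
    (hL 1 e).trans (K.map_one_left _)
  have hLk (k : H) (e : ESpace H) : L (1, k • e) = k • L (1, e) := by
    refine congrFun (covH.eq_of_comp_eq (g₁ := fun t => L (t, k • e)) (g₂ := fun t => k • L (t, e))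
      (by fun_prop) (by fun_prop) (funext fun t => ?_) 0 ?_) 1
    · simp only [Function.comp_apply, proj_smul, hL]
    · simp only [hL₀]
  obtain ⟨e₀⟩ : Nonempty (ESpace H) := inferInstance
  obtain ⟨f₀, hf₀⟩ := proj_surjective (r (proj H e₀))
  -- the element `c` compares the two lifts of `Bφ (r (p e₀))` to `EH`
  obtain ⟨c, hc⟩ : ∃ c : H, c • map φ f₀ = L (1, e₀) := by
    refine hpH.apply_eq_iff_mem_orbit.mp ?_
    rw [hL₁, ← hf₀, classifyingSpaceMap_proj]
  suffices h : ∀ k : H, ∃ ρ, k * c = c * φ ρ by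
    intro k
    obtain ⟨ρ, hρ⟩ := h (c * k * c⁻¹)
    exact ⟨ρ, by simpa using hρ.symm⟩
  intro k
  obtain ⟨γ⟩ := PathConnectedSpace.joined e₀ (k • e₀)
  let Λ : C(I, ESpace G) := covG.liftPath (r.comp ((proj H).hom.comp γ.toContinuousMap)) f₀ (by
    simpa using hf₀.symm)
  have hΛ (t : I) : proj G (Λ t) = r (proj H (γ t)) := congrFun (covG.liftPath_lifts _ _ _) t
  have hΛ₀ : Λ 0 = f₀ := covG.liftPath_zero _ _ _
  obtain ⟨ρ, hρ⟩ : ∃ ρ : G, ρ • f₀ = Λ 1 := by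
    refine hpG.apply_eq_iff_mem_orbit.mp ?_
    rw [hΛ, hf₀, γ.target, proj_smul]
  refine ⟨ρ, ?_⟩
  have key : L (1, γ 1) = c • map φ (Λ 1) := by
    refine congrFun (covH.eq_of_comp_eq (g₁ := fun t => L (1, γ t))
      (g₂ := fun t => c • map φ (Λ t)) (by fun_prop) ?_ (funext fun t => ?_) 0 ?_) 1
    · exact ((map φ).hom.continuous.comp Λ.continuous).const_smul c
    · simp only [Function.comp_apply, proj_smul, hL₁, ← classifyingSpaceMap_proj, hΛ]
    · simp only [γ.source, hΛ₀, hc]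
  rw [γ.target, hLk, ← hρ, map_smul_eq, ← hc, smul_smul, smul_smul] at key
  exact hpH.toPermFiber_ext _ ⟨map φ f₀, rfl⟩ (Subtype.ext key)

end ClassifyingSpace

end

/-! ### Maps in the homotopy category -/

noncomputable section

open Cardinal

/-- A homomorphism which is not surjective does not induce a homotopy equivalence of classifying
spaces. Homotopies are unpointed here. -/
theorem not_isIso_homotopyClass_classifyingSpaceMap {G : Type u} [Group G] {φ : G →* G}
    (hφ : ¬ Function.Surjective φ) (hCW : Nonempty (TopCat.CWComplex (classifyingSpace G))) :
    ¬ IsIso (Hot.homotopyClass (X := ⟨classifyingSpace G, hCW⟩) (Y := ⟨classifyingSpace G, hCW⟩)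
      (classifyingSpaceMap φ)) := by
  intro h
  obtain ⟨r, -, hr⟩ := h.out
  obtain ⟨r⟩ := r
  refine hφ (surjective_of_homotopic_id φ r (ContinuousMap.Homotopic.symm ?_))
  exact (Hot.homotopyClass_eq_iff (X := ⟨classifyingSpace G, hCW⟩)
    (Y := ⟨classifyingSpace G, hCW⟩) (TopCat.ofHom r ≫ classifyingSpaceMap φ) (𝟙 _)).mp hr

/-- `Bs` induces the identity on homotopy classes of maps from spaces with small fundamental
groups. -/
theorem comp_homotopyClass_shift {α : Cardinal.{u}} (hα : α.IsRegular) {S : Hot.{u}}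
    (hS : ∀ s : S.space, #(FundamentalGroup S.space s) < α)
    (hCW : Nonempty (TopCat.CWComplex (classifyingSpace (essConstPerm α.ord))))
    (h : S ⟶ ⟨classifyingSpace (essConstPerm α.ord), hCW⟩) :
    h ≫ Hot.homotopyClass (X := ⟨classifyingSpace (essConstPerm α.ord), hCW⟩)
      (Y := ⟨classifyingSpace (essConstPerm α.ord), hCW⟩)
      (classifyingSpaceMap (shift α hα.aleph0_le)) = h := by
  obtain ⟨h⟩ := h
  have := S.isCW.some.locallyPathConnectedSpace
  have key := homotopic_classifyingSpaceMap_comp (shift α hα.aleph0_le) (MonoidHom.id _)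
    (exists_shift_mul_eq hα) hS h
  have hid : classifyingSpaceMap (MonoidHom.id (essConstPerm α.ord)) = 𝟙 _ :=
    SSet.toTop.map_id _
  rw [hid] at key
  exact Quotient.sound (s := Hot.homotopySetoid _ _) key.symm

theorem bijective_comp_of_forall_comp_eq {C : Type*} [Category C] {S X : C} {f : X ⟶ X}
    (hf : ∀ h : S ⟶ X, h ≫ f = h) : Function.Bijective fun h : S ⟶ X => h ≫ f := by
  simp only [hf]
  exact Function.bijective_id

end

theorem theorem2p1 :
    -- no small set of spaces jointly reflects isomorphisms in the homotopy category of spaces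
    (¬ ∃ G : Set Hot.{u}, Small.{u} G ∧ JointlyReflectsIsos G) ∧
    -- for every small set `G`, the explicit counterexample `Bs`
    (∀ G : Set Hot.{u}, Small.{u} G →
      (∃ α : Cardinal.{u}, IsLargeFor α G) ∧
      ∀ (α : Cardinal.{u}) (hα : IsLargeFor α G),
        ConnectedSpace (classifyingSpace (essConstPerm α.ord)) ∧
        ∃ hCW : Nonempty (TopCat.CWComplex (classifyingSpace (essConstPerm α.ord))),
          let X : Hot.{u} := ⟨classifyingSpace (essConstPerm α.ord), hCW⟩
          let Bs : X ⟶ X :=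
            Hot.homotopyClass (X := X) (Y := X) (classifyingSpaceMap (shift α hα.1.aleph0_le))
          ¬ IsIso Bs ∧ ∀ S ∈ G, ∀ h : S ⟶ X, h ≫ Bs = h) ∧
    -- no small set of connected spaces does so in the homotopy category of connected spaces
    (¬ ∃ G : Set HotConnected.{u}, Small.{u} G ∧ JointlyReflectsIsos G) := by
  refine ⟨?_, fun G _ => ⟨exists_isLargeFor G, fun α hα => ⟨connectedSpace_classifyingSpace _,
    nonempty_cwComplex_toTop _, not_isIso_homotopyClass_classifyingSpaceMap
      (not_surjective_shift hα.1) _, fun S hS => comp_homotopyClass_shift hα.1 (hα.2 S hS) _⟩⟩, ?_⟩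
  · rintro ⟨G, hG, hrefl⟩
    obtain ⟨α, hα⟩ := exists_isLargeFor G
    exact not_isIso_homotopyClass_classifyingSpaceMap (not_surjective_shift hα.1)
      (nonempty_cwComplex_toTop _) (hrefl _ fun S hS =>
        bijective_comp_of_forall_comp_eq (comp_homotopyClass_shift hα.1 (hα.2 S hS) _))
  · rintro ⟨G, hG, hrefl⟩
    obtain ⟨α, hα⟩ := exists_isLargeFor ((fun S : HotConnected.{u} => S.obj) '' G)
    have hCW := nonempty_cwComplex_toTop (nerve (SingleObj (essConstPerm α.ord)))
    let X : HotConnected.{u} := ⟨⟨classifyingSpace (essConstPerm α.ord), hCW⟩,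
      connectedSpace_classifyingSpace _⟩
    let f : X ⟶ X := ObjectProperty.homMk (Hot.homotopyClass (X := X.obj) (Y := X.obj)
      (classifyingSpaceMap (shift α hα.1.aleph0_le)))
    have : IsIso f := hrefl f fun S hS => bijective_comp_of_forall_comp_eq fun h =>
      ObjectProperty.hom_ext _ (comp_homotopyClass_shift hα.1 (hα.2 S.obj ⟨S, hS, rfl⟩) hCW h.hom)
    exact not_isIso_homotopyClass_classifyingSpaceMap (not_surjective_shift hα.1) hCW
      ((ObjectProperty.ι _).map_isIso f)
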